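/- **Setting.** Let $m_1,m_2\ge 1$, $m=m_1+m_2$, $j=\mathrm{diag}(I_{m_1},-I_{m_2})$, $r\in\mathbb N_0$, and let $C_0,\dots,C_r$ be $m\times m$ complex matrices with $C_k>0$ and $C_kjC_k=j$. Let $W_0(z)=I_m$, $W_{k+1}(z)=(I_m+\mathrm i z jC_k)W_k(z)$ $(0\le k\le r)$ be the normalized fundamental solution of the discrete Dirac system $y_{k+1}(z)=(I_m+\mathrm i zjC_k)y_k(z)$. A *Weyl function* of this system on $0\le k\le r$ is an $m_2\times m_1$ matrix function $$\varphi(z)=-\begin{bmatrix}0&I_{m_2}\end{bmatrix}W_{r+1}(\bar z)^*\mathcal P(z)\Big(\begin{bmatrix}I_{m_1}&0\end{bmatrix}W_{r+1}(\bar z)^*\mathcal P(z)\Big)^{-1},$$ where $\mathcal P$ is an $m\times m_1$ matrix function, meromorphic in $\mathbb C_+$, such that $\mathcal P(z)^*\mathcal P(z)>0$ and $\mathcal P(z)^*j\mathcal P(z)\ge0$ in $\mathbb C_+$ outside a discrete set, and such that $\mathcal P$ is holomorphic at $\mathrm i$ with $\mathcal P(\mathrm i)^*\mathcal P(\mathrm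 i)>0$. The formula for $\varphi$ is required to hold at $z=\mathrm i$ and on $\mathbb C_+$ outside a discrete set. Put $\gamma(k)=\begin{bmatrix}0&I_{m_2}\end{bmatrix}C_k^{1/2}$ (positive square root). Let $\Gamma_k=\begin{bmatrix}\Gamma_{k,1}&\Gamma_{k,2}\end{bmatrix}$ be the block column of $\gamma(0),\dots,\gamma(k)$, with $\Gamma_{k,p}$ having $m_p$ columns. Let $K_k$ be the block lower triangular matrix with blocks $\mathrm i\gamma(l)j\gamma(n)^*$ for $n<l$ and $\tfrac{\mathrm i}{2}\gamma(l)j\gamma(l)^*$ on the diagonal $(0\le l,n\le k)$. Let $A_k$ be the block lower triangular matrix with $m_2\times m_2$ blocks $-\mathrm i I_{m_2}$ below the diagonal and $-\tfrac{\mathrm i}{2}I_{m_2}$ on the diagonal. Let $\Phi_{k,2}$ be the block column of $k+1$ copies of $I_{m_2}$, and let $P=\begin{bmatrix}0&\dots&0&I_{m_2}\end{bmatrix}$ be of size $m_2\times(k+1)m_2$. **Theorem 4.4.** Let $\varphi$ be a Weyl function of the above system on $0\le k\le r$. Then $z\mapsto\varphi\big(\mathrm i\frac{1-z}{1+z}\big)$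 is analytic at $z=0$, and $\{C_k\}_{k=0}^r$ is uniquely determined by its first $r+1$ Taylor coefficients there: write $\varphi\big(\mathrm i\frac{1-z}{1+z}\big)=\sum_{k=0}^r\phi_kz^k+O(z^{r+1})$ as $z\to0$; if $\widetilde\varphi$ is a Weyl function on $0\le k\le r$ of a system with potential $\{\widetilde C_k\}_{k=0}^r$, $\widetilde C_k>0$, $\widetilde C_kj\widetilde C_k=j$, and has an expansion with the same $\phi_0,\dots,\phi_r$, then $\widetilde C_k=C_k$ for $0\le k\le r$. The recovery is explicit. For every $0\le k\le r$: 1. There is exactly one invertible matrix $E_k$ with $K_k=E_kA_kE_k^{-1}$ and $E_k^{-1}\Gamma_{k,2}=\Phi_{k,2}$, and the matrix $\Phi_{k,1}:=E_k^{-1}\Gamma_{k,1}$ is given by $$\Phi_{k,1}=-\begin{bmatrix}\phi_0\\ \phi_0+\phi_1\\ \vdots\\ \phi_0+\phi_1+\dots+\phi_k\end{bmatrix}.$$ 2. With $\Pi_k=\begin{bmatrix}\Phi_{k,1}&\Phi_{k,2}\end{bmatrix}$, the identity $A_kS_k-S_kA_k^*=\mathrm i\Pi_kj\Pi_k^*$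 has a unique solution $S_k$. Moreover $S_k=E_k^{-1}(E_k^*)^{-1}>0$. 3. The matrix $PS_k^{-1}P^*$ is invertible, and $$\gamma(k)^*\gamma(k)=\Pi_k^*S_k^{-1}P^*(PS_k^{-1}P^*)^{-1}PS_k^{-1}\Pi_k.$$ 4. $C_k=j+2\gamma(k)^*\gamma(k)$. -/

import Mathlib

open scoped Matrix ComplexOrder MatrixOrder

namespace DiscreteDirac

noncomputable section

/-- The signature matrix `j = diag (I_{m₁}, -I_{m₂})`. -/
def sig (m₁ m₂ : ℕ) : Matrix (Fin m₁ ⊕ Fin m₂) (Fin m₁ ⊕ Fin m₂) ℂ :=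
  Matrix.fromBlocks 1 0 0 (-1)

/-- The row `[I_{m₁}  0]`. -/
def topRow (m₁ m₂ : ℕ) : Matrix (Fin m₁) (Fin m₁ ⊕ Fin m₂) ℂ :=
  Matrix.fromCols 1 0

/-- The row `[0  I_{m₂}]`. -/
def botRow (m₁ m₂ : ℕ) : Matrix (Fin m₂) (Fin m₁ ⊕ Fin m₂) ℂ :=
  Matrix.fromCols 0 1

variable {m₁ m₂ : ℕ}

/-- The matrices `C_0, …, C_r` are positive definite and `j`-unitary.
The values of `C k` for `k > r` are irrelevant. -/
def IsPotential (C : ℕ → Matrix (Fin m₁ ⊕ Fin m₂) (Fin m₁ ⊕ Fin m₂) ℂ) (r : ℕ) : Prop :=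
  ∀ k ≤ r, (C k).PosDef ∧ C k * sig m₁ m₂ * C k = sig m₁ m₂

/-- The fundamental solution of `y_{k+1}(z) = (I + i z j C_k) y_k(z)`, normalized by `W_0 = I`. -/
def fundSol (C : ℕ → Matrix (Fin m₁ ⊕ Fin m₂) (Fin m₁ ⊕ Fin m₂) ℂ) (z : ℂ) :
    ℕ → Matrix (Fin m₁ ⊕ Fin m₂) (Fin m₁ ⊕ Fin m₂) ℂ
  | 0 => 1
  | k + 1 => (1 + (Complex.I * z) • (sig m₁ m₂ * C k)) * fundSol C z k

/-- The linear-fractional transformation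
`-[0 I] W_{r+1}(z̄)^* 𝓟 ([I 0] W_{r+1}(z̄)^* 𝓟)⁻¹` of an `m × m₁` matrix `𝓟`. -/
def moebius (C : ℕ → Matrix (Fin m₁ ⊕ Fin m₂) (Fin m₁ ⊕ Fin m₂) ℂ) (r : ℕ) (z : ℂ)
    (P : Matrix (Fin m₁ ⊕ Fin m₂) (Fin m₁) ℂ) : Matrix (Fin m₂) (Fin m₁) ℂ :=
  -(botRow m₁ m₂ * (fundSol C (star z) (r + 1))ᴴ * P) *
    (topRow m₁ m₂ * (fundSol C (star z) (r + 1))ᴴ * P)⁻¹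

/-- The open upper half-plane `ℂ₊`. -/
def upperHalf : Set ℂ := {z | 0 < z.im}

/-- Admissible parameters: `m × m₁` matrix functions `𝓟`, meromorphic in `ℂ₊`, with
`𝓟^* 𝓟 > 0` and `𝓟^* j 𝓟 ≥ 0` in `ℂ₊` outside a discrete set, which are
moreover well-defined (holomorphic) and nonsingular at `i`. -/
structure IsParameter (P : ℂ → Matrix (Fin m₁ ⊕ Fin m₂) (Fin m₁) ℂ) : Prop where
  meromorphic : ∀ a b, MeromorphicOn (fun z => P z a b) upperHalf
  property_j : ∀ᶠ z in Filter.codiscreteWithin upperHalf,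
    ((P z)ᴴ * P z).PosDef ∧ ((P z)ᴴ * sig m₁ m₂ * P z).PosSemidef
  analyticAt_I : ∀ a b, AnalyticAt ℂ (fun z => P z a b) Complex.I
  nonsingular_I : ((P Complex.I)ᴴ * P Complex.I).PosDef

/-- `φ` is a Weyl function of the system on the interval `0 ≤ k ≤ r`: it is the
linear-fractional transformation of an admissible parameter. The equality is an equality of
meromorphic functions on `ℂ₊`, i.e. it is required outside a discrete subset of `ℂ₊`
(where `𝓟` may have poles, or degenerate), this set not containing the point `i`. -/
def IsWeylFunction (C : ℕ → Matrix (Fin m₁ ⊕ Fin m₂) (Fin m₁ ⊕ Fin m₂) ℂ) (r : ℕ)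
    (φ : ℂ → Matrix (Fin m₂) (Fin m₁) ℂ) : Prop :=
  ∃ P : ℂ → Matrix (Fin m₁ ⊕ Fin m₂) (Fin m₁) ℂ, IsParameter P ∧
    (∀ᶠ z in Filter.codiscreteWithin upperHalf, φ z = moebius C r z (P z)) ∧
    φ Complex.I = moebius C r Complex.I (P Complex.I)

/-- The function `z ↦ φ (i (1 - z) / (1 + z))`. -/
def onDisk (φ : ℂ → Matrix (Fin m₂) (Fin m₁) ℂ) (z : ℂ) : Matrix (Fin m₂) (Fin m₁) ℂ :=
  φ (Complex.I * ((1 - z) / (1 + z)))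

/-- `φ (i (1 - z) / (1 + z)) = ∑_{k=0}^r a_k z^k + O(z^{r+1})` as `z → 0`, entrywise. -/
def HasTaylor (φ : ℂ → Matrix (Fin m₂) (Fin m₁) ℂ) (r : ℕ)
    (a : ℕ → Matrix (Fin m₂) (Fin m₁) ℂ) : Prop :=
  ∀ p q, (fun z : ℂ => onDisk φ z p q - ∑ k ∈ Finset.range (r + 1), z ^ k * a k p q)
    =O[nhds 0] fun z : ℂ => z ^ (r + 1)

/-- `γ = [0 I] C^{1/2}`, with the positive square root. -/
def gam (C : Matrix (Fin m₁ ⊕ Fin m₂) (Fin m₁ ⊕ Fin m₂) ℂ) :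
    Matrix (Fin m₂) (Fin m₁ ⊕ Fin m₂) ℂ :=
  botRow m₁ m₂ * CFC.sqrt C

/-- The block column `Γ_k` with the blocks `γ(0), …, γ(k)`. -/
def Gam (C : ℕ → Matrix (Fin m₁ ⊕ Fin m₂) (Fin m₁ ⊕ Fin m₂) ℂ) (k : ℕ) :
    Matrix (Fin (k + 1) × Fin m₂) (Fin m₁ ⊕ Fin m₂) ℂ :=
  Matrix.of fun x y => gam (C x.1) x.2 y

/-- The block lower triangular matrix `K_k`, with the blocks `i γ(l) j γ(n)^*` for `n < l` and
`i γ(l) j γ(l)^* / 2` on the diagonal. -/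
def Kmat (C : ℕ → Matrix (Fin m₁ ⊕ Fin m₂) (Fin m₁ ⊕ Fin m₂) ℂ) (k : ℕ) :
    Matrix (Fin (k + 1) × Fin m₂) (Fin (k + 1) × Fin m₂) ℂ :=
  Matrix.of fun x y =>
    (if y.1 < x.1 then Complex.I else if y.1 = x.1 then Complex.I / 2 else 0) *
      (gam (C x.1) * sig m₁ m₂ * (gam (C y.1))ᴴ) x.2 y.2

/-- The block lower triangular Toeplitz matrix `A_k`, with the blocks `-i I` below the diagonal
and `-(i/2) I` on the diagonal. -/
def Amat (m₂ k : ℕ) : Matrix (Fin (k + 1) × Fin m₂) (Fin (k + 1) × Fin m₂) ℂ :=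
  Matrix.of fun x y =>
    (if y.1 < x.1 then -Complex.I else if y.1 = x.1 then -(Complex.I / 2) else 0) *
      (1 : Matrix (Fin m₂) (Fin m₂) ℂ) x.2 y.2

/-- `Φ_{k,2}`: the block column of `k + 1` identity matrices `I_{m₂}`. -/
def Phi2 (m₂ k : ℕ) : Matrix (Fin (k + 1) × Fin m₂) (Fin m₂) ℂ :=
  Matrix.of fun x q => (1 : Matrix (Fin m₂) (Fin m₂) ℂ) x.2 q

/-- `Φ_{k,1}`: the block column with the blocks `-(a_0 + … + a_l)`, `0 ≤ l ≤ k`. -/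
def Phi1 (a : ℕ → Matrix (Fin m₂) (Fin m₁) ℂ) (k : ℕ) :
    Matrix (Fin (k + 1) × Fin m₂) (Fin m₁) ℂ :=
  Matrix.of fun x q => -(∑ i ∈ Finset.range ((x.1 : ℕ) + 1), a i x.2 q)

/-- `Π_k = [Φ_{k,1}  Φ_{k,2}]`. -/
def PiMat (a : ℕ → Matrix (Fin m₂) (Fin m₁) ℂ) (k : ℕ) :
    Matrix (Fin (k + 1) × Fin m₂) (Fin m₁ ⊕ Fin m₂) ℂ :=
  Matrix.fromCols (Phi1 a k) (Phi2 m₂ k)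

/-- `P = [0 … 0 I_{m₂}]`. -/
def lastRow (m₂ k : ℕ) : Matrix (Fin m₂) (Fin (k + 1) × Fin m₂) ℂ :=
  Matrix.of fun p y => if y.1 = Fin.last k then (1 : Matrix (Fin m₂) (Fin m₂) ℂ) p y.2 else 0

/-- The similarity transformation `E_k` of the system: it is invertible,
`K_k = E_k A_k E_k⁻¹`, and `E_k⁻¹ Γ_{k,2} = Φ_{k,2}`, where `Γ_k = [Γ_{k,1}  Γ_{k,2}]`. -/
def IsSimilarity (C : ℕ → Matrix (Fin m₁ ⊕ Fin m₂) (Fin m₁ ⊕ Fin m₂) ℂ) (k : ℕ)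
    (E : Matrix (Fin (k + 1) × Fin m₂) (Fin (k + 1) × Fin m₂) ℂ) : Prop :=
  IsUnit E ∧ Kmat C k = E * Amat m₂ k * E⁻¹ ∧ E⁻¹ * (Gam C k).toCols₂ = Phi2 m₂ k

/-- The matrix identity `A_k S - S A_k^* = i Π_k j Π_k^*`. -/
def SolvesIdentity (a : ℕ → Matrix (Fin m₂) (Fin m₁) ℂ) (k : ℕ)
    (S : Matrix (Fin (k + 1) × Fin m₂) (Fin (k + 1) × Fin m₂) ℂ) : Prop :=
  Amat m₂ k * S - S * (Amat m₂ k)ᴴ =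
    Complex.I • (PiMat a k * sig m₁ m₂ * (PiMat a k)ᴴ)

end

end DiscreteDirac

namespace DiscreteDirac

open Matrix Filter Topology

/-! ### The signature matrix, `j`-unitary square roots, and nonnegative frames -/

section

variable {m₁ m₂ : ℕ}

/-! Because `C_k^{1/2}` is `j`-unitary, `γ(k) j γ(k)^* = -I`. Hence `K_k` and `A_k` have the same
scalar diagonal `-i/2`, and their similarity reduces to that of two nilpotent, strictly block lower
triangular matrices with invertible subdiagonal blocks. Together with `Γ_{k,2}` and `Φ_{k,2}` they
form cyclic pairs, so matching Krylov bases gives exactly one `E_k`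
(`IsCyclicPair.exists_intertwine`, `IsCyclicPair.mul_right_ext`).

The identity `K - K^* = i Γ j Γ^*`, conjugated by `E`, says that `S = E⁻¹ (E^*)⁻¹` solves the
equation for `S_k`. The solution is unique since `A` and `A^*` have the disjoint spectra `{-i/2}`
and `{i/2}`. As `E` preserves the last block, the projected formula isolates `γ(k)`
(`IsSimilarity.recovery`).

It remains to see that `E⁻¹ Γ_{k,1}` consists of Taylor data. In the disk variable `ζ`, the column
`[I; φ]` starts a recursion with analytic terms (`IsWeylFunction.exists_jet`). Summing it and
applying `E⁻¹` gives `(ζ - (1 - ζ) N) η = E⁻¹ Γ_{k,1} + Φ_{k,2} φ`, with `N` the strictly lower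
block matrix of identities and `η` analytic. Multiplying on the left by `[I, ζ I, …, ζ^k I]` turns
the left side into `O(ζ^{k+1})`, and comparing coefficients gives the partial sums
(`IsWeylFunction.phi1_eq`). Everything on the right of the recovery formula then depends on the
Taylor coefficients alone, whence uniqueness. -/

theorem topRow_mul_conjTranspose : topRow m₁ m₂ * (topRow m₁ m₂)ᴴ = 1 := by
  simp [topRow, conjTranspose_fromCols_eq_fromRows_conjTranspose, fromCols_mul_fromRows]

theorem sig_eq : sig m₁ m₂ =
    (topRow m₁ m₂)ᴴ * topRow m₁ m₂ - (botRow m₁ m₂)ᴴ * botRow m₁ m₂ := by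
  simp only [sig, topRow, botRow, conjTranspose_fromCols_eq_fromRows_conjTranspose,
    fromRows_mul_fromCols]
  ext (i | i) (k | k) <;> simp

theorem conjTranspose_mul_rows :
    (topRow m₁ m₂)ᴴ * topRow m₁ m₂ + (botRow m₁ m₂)ᴴ * botRow m₁ m₂ = 1 := by
  simp only [topRow, botRow, conjTranspose_fromCols_eq_fromRows_conjTranspose,
    fromRows_mul_fromCols, ← fromBlocks_one]
  ext (i | i) (k | k) <;> simp

theorem one_add_sig : 1 + sig m₁ m₂ = (2 : ℂ) • ((topRow m₁ m₂)ᴴ * topRow m₁ m₂) := by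
  rw [sig_eq, ← conjTranspose_mul_rows, two_smul]; abel

theorem one_sub_sig : 1 - sig m₁ m₂ = (2 : ℂ) • ((botRow m₁ m₂)ᴴ * botRow m₁ m₂) := by
  rw [sig_eq, ← conjTranspose_mul_rows, two_smul]; abel

theorem sig_mul_sig : sig m₁ m₂ * sig m₁ m₂ = 1 := by
  simp [sig, fromBlocks_multiply]

theorem conjTranspose_sig : (sig m₁ m₂)ᴴ = sig m₁ m₂ := by
  simp [sig, fromBlocks_conjTranspose]

theorem isUnit_sig : IsUnit (sig m₁ m₂) :=
  IsUnit.of_mul_eq_one _ sig_mul_sig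

theorem sig_mul_topRow : sig m₁ m₂ * (topRow m₁ m₂)ᴴ = (topRow m₁ m₂)ᴴ := by
  simp [sig, topRow, conjTranspose_fromCols_eq_fromRows_conjTranspose, fromBlocks_mul_fromRows]

theorem botRow_mul_sig : botRow m₁ m₂ * sig m₁ m₂ = -botRow m₁ m₂ := by
  simp [sig, botRow, fromCols_mul_fromBlocks, fromCols_neg]

theorem botRow_mul_conjTranspose : botRow m₁ m₂ * (botRow m₁ m₂)ᴴ = 1 := by
  simp [botRow, conjTranspose_fromCols_eq_fromRows_conjTranspose, fromCols_mul_fromRows]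

theorem mul_conjTranspose_botRow {n : Type*} (A : Matrix n (Fin m₁ ⊕ Fin m₂) ℂ) :
    A * (botRow m₁ m₂)ᴴ = A.toCols₂ := by
  rw [botRow, conjTranspose_fromCols_eq_fromRows_conjTranspose, ← A.fromCols_toCols,
    fromCols_mul_fromRows]
  simp

theorem isUnit_of_posDef_conjTranspose_mul_self {n : Type*} [Fintype n] [DecidableEq n]
    {A : Matrix n n ℂ} (h : (Aᴴ * A).PosDef) : IsUnit A := by
  have h := h.isUnit
  rw [isUnit_iff_isUnit_det, det_mul] at h
  rw [isUnit_iff_isUnit_det]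
  exact isUnit_of_mul_isUnit_right h

theorem mulVec_injective_of_posDef {n p : Type*} [Fintype n] [Fintype p] [DecidableEq n]
    {Q : Matrix p n ℂ} (h : (Qᴴ * Q).PosDef) : Function.Injective Q.mulVec := by
  have := mulVec_injective_of_isUnit h.isUnit
  intro x y hxy
  apply this
  simp only [← mulVec_mulVec, hxy]

/-- A positive definite `j`-unitary matrix has a `j`-unitary square root. -/
theorem sqrt_mul_sig_mul_sqrt {C : Matrix (Fin m₁ ⊕ Fin m₂) (Fin m₁ ⊕ Fin m₂) ℂ}
    (hC : C.PosDef) (hj : C * sig m₁ m₂ * C = sig m₁ m₂) :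
    CFC.sqrt C * sig m₁ m₂ * CFC.sqrt C = sig m₁ m₂ := by
  have hR : (CFC.sqrt C).PosDef := (IsStrictlyPositive.sqrt C hC.isStrictlyPositive).posDef
  have hRR : CFC.sqrt C * CFC.sqrt C = C := CFC.sqrt_mul_sqrt_self C hC.posSemidef.nonneg
  have hinv : C⁻¹ = sig m₁ m₂ * C * sig m₁ m₂ := by
    apply inv_eq_left_inv
    rw [Matrix.mul_assoc, Matrix.mul_assoc, ← Matrix.mul_assoc C, hj, sig_mul_sig]
  -- Since `C⁻¹ = j C j`, uniqueness of the positive square root gives `C^{-1/2} = j C^{1/2} j`.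
  have h1 : CFC.sqrt C⁻¹ = sig m₁ m₂ * CFC.sqrt C * sig m₁ m₂ := by
    apply CFC.sqrt_unique
    · rw [hinv]
      calc _ = sig m₁ m₂ * CFC.sqrt C * (sig m₁ m₂ * sig m₁ m₂) * CFC.sqrt C * sig m₁ m₂ := by
            simp only [Matrix.mul_assoc]
        _ = _ := by
            rw [sig_mul_sig, Matrix.mul_one, Matrix.mul_assoc (sig m₁ m₂) (CFC.sqrt C), hRR]
    · have := hR.posSemidef.conjTranspose_mul_mul_same (sig m₁ m₂)
      rw [conjTranspose_sig] at this
      exact this.nonneg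
  rw [← hC.posSemidef.inv_sqrt] at h1
  have h2 := congrArg (fun X => sig m₁ m₂ * (X * CFC.sqrt C)) h1
  simp only [nonsing_inv_mul _ ((isUnit_iff_isUnit_det _).1 hR.isUnit), Matrix.mul_one,
    ← Matrix.mul_assoc, sig_mul_sig, Matrix.one_mul] at h2
  exact h2.symm

theorem conjTranspose_sqrt (C : Matrix (Fin m₁ ⊕ Fin m₂) (Fin m₁ ⊕ Fin m₂) ℂ) :
    (CFC.sqrt C)ᴴ = CFC.sqrt C :=
  (CFC.sqrt_nonneg C).posSemidef.1

theorem gam_mul_sig_mul_gam {C : Matrix (Fin m₁ ⊕ Fin m₂) (Fin m₁ ⊕ Fin m₂) ℂ}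
    (hC : C.PosDef) (hj : C * sig m₁ m₂ * C = sig m₁ m₂) :
    gam C * sig m₁ m₂ * (gam C)ᴴ = -1 := by
  rw [gam, conjTranspose_mul, conjTranspose_sqrt]
  calc _ = botRow m₁ m₂ * (CFC.sqrt C * sig m₁ m₂ * CFC.sqrt C) * (botRow m₁ m₂)ᴴ := by
        simp only [Matrix.mul_assoc]
    _ = -1 := by
        rw [sqrt_mul_sig_mul_sqrt hC hj, botRow_mul_sig, Matrix.neg_mul, botRow_mul_conjTranspose]

theorem eq_sig_add {C : Matrix (Fin m₁ ⊕ Fin m₂) (Fin m₁ ⊕ Fin m₂) ℂ}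
    (hC : C.PosDef) (hj : C * sig m₁ m₂ * C = sig m₁ m₂) :
    C = sig m₁ m₂ + (2 : ℂ) • ((gam C)ᴴ * gam C) := by
  have h : (2 : ℂ) • ((gam C)ᴴ * gam C) = CFC.sqrt C * (1 - sig m₁ m₂) * CFC.sqrt C := by
    rw [gam, conjTranspose_mul, conjTranspose_sqrt, one_sub_sig]
    simp only [Matrix.mul_assoc, Matrix.mul_smul, Matrix.smul_mul]
  rw [h, Matrix.mul_sub, Matrix.sub_mul, sqrt_mul_sig_mul_sqrt hC hj, Matrix.mul_one,
    CFC.sqrt_mul_sqrt_self C hC.posSemidef.nonneg]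
  abel

/-- `U = C^{1/2} j C'^{1/2}` is `j`-unitary, so its lower blocks satisfy `U₂₂ U₂₂^* = I + U₂₁ U₂₁^*
> 0`; the matrix in question is `U₂₂^*`. -/
theorem isUnit_gam_mul_sig_mul_gam {C C' : Matrix (Fin m₁ ⊕ Fin m₂) (Fin m₁ ⊕ Fin m₂) ℂ}
    (hC : C.PosDef) (hj : C * sig m₁ m₂ * C = sig m₁ m₂)
    (hC' : C'.PosDef) (hj' : C' * sig m₁ m₂ * C' = sig m₁ m₂) :
    IsUnit (gam C' * sig m₁ m₂ * (gam C)ᴴ) := by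
  set U := CFC.sqrt C * sig m₁ m₂ * CFC.sqrt C' with hU
  have hUH : Uᴴ = CFC.sqrt C' * sig m₁ m₂ * CFC.sqrt C := by
    simp only [hU, conjTranspose_mul, conjTranspose_sqrt, conjTranspose_sig, Matrix.mul_assoc]
  have hUU : U * sig m₁ m₂ * Uᴴ = sig m₁ m₂ := by
    calc _ = CFC.sqrt C * sig m₁ m₂ * (CFC.sqrt C' * sig m₁ m₂ * CFC.sqrt C') * sig m₁ m₂ *
          CFC.sqrt C := by rw [hUH, hU]; simp only [Matrix.mul_assoc]
      _ = _ := by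
        rw [sqrt_mul_sig_mul_sqrt hC' hj', Matrix.mul_assoc (CFC.sqrt C), sig_mul_sig,
          Matrix.mul_one, sqrt_mul_sig_mul_sqrt hC hj]
  have hG : gam C' * sig m₁ m₂ * (gam C)ᴴ = (botRow m₁ m₂ * U * (botRow m₁ m₂)ᴴ)ᴴ := by
    simp only [gam, conjTranspose_mul, conjTranspose_sqrt, hUH, conjTranspose_conjTranspose,
      Matrix.mul_assoc]
  have key : (botRow m₁ m₂ * U * (botRow m₁ m₂)ᴴ) * (botRow m₁ m₂ * U * (botRow m₁ m₂)ᴴ)ᴴ =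
      1 + (botRow m₁ m₂ * U * (topRow m₁ m₂)ᴴ) * (botRow m₁ m₂ * U * (topRow m₁ m₂)ᴴ)ᴴ := by
    have h := congrArg (fun X => botRow m₁ m₂ * X * (botRow m₁ m₂)ᴴ) hUU
    simp only [botRow_mul_sig, Matrix.neg_mul, botRow_mul_conjTranspose] at h
    rw [sig_eq] at h
    simp only [Matrix.mul_sub, Matrix.sub_mul] at h
    rw [sub_eq_iff_eq_add] at h
    simp only [conjTranspose_mul, conjTranspose_conjTranspose]
    simp only [← Matrix.mul_assoc] at h ⊢
    rw [h]; abel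
  rw [hG]
  apply isUnit_of_posDef_conjTranspose_mul_self
  rw [conjTranspose_conjTranspose, key]
  exact PosDef.one.add_posSemidef (posSemidef_self_mul_conjTranspose _)

theorem isUnit_toCols₂_gam {C : Matrix (Fin m₁ ⊕ Fin m₂) (Fin m₁ ⊕ Fin m₂) ℂ}
    (hC : C.PosDef) : IsUnit (gam C).toCols₂ := by
  have hR : (CFC.sqrt C).PosDef := (IsStrictlyPositive.sqrt C hC.isStrictlyPositive).posDef
  rw [← mul_conjTranspose_botRow, gam]
  have h := hR.conjTranspose_mul_mul_same (B := (botRow m₁ m₂)ᴴ)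
    (mulVec_injective_of_posDef (by
      rw [conjTranspose_conjTranspose, botRow_mul_conjTranspose]; exact PosDef.one))
  rw [conjTranspose_conjTranspose] at h
  exact h.isUnit

/-- The columns of `Q` span a maximal `j`-nonnegative subspace. -/
def IsNonnegFrame (Q : Matrix (Fin m₁ ⊕ Fin m₂) (Fin m₁) ℂ) : Prop :=
  (Qᴴ * Q).PosDef ∧ (Qᴴ * sig m₁ m₂ * Q).PosSemidef

/-- The Gram matrix of the upper block of `Q` is half of `Q^* Q + Q^* j Q`, which is positive
definite. -/
theorem IsNonnegFrame.isUnit_topRow_mul {Q : Matrix (Fin m₁ ⊕ Fin m₂) (Fin m₁) ℂ}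
    (hQ : IsNonnegFrame Q) : IsUnit (topRow m₁ m₂ * Q) := by
  apply isUnit_of_posDef_conjTranspose_mul_self
  have h : (topRow m₁ m₂ * Q)ᴴ * (topRow m₁ m₂ * Q) =
      (2⁻¹ : ℂ) • (Qᴴ * Q + Qᴴ * sig m₁ m₂ * Q) := by
    have h1 : Qᴴ * Q + Qᴴ * sig m₁ m₂ * Q = Qᴴ * (1 + sig m₁ m₂) * Q := by
      rw [Matrix.mul_add, Matrix.mul_one, Matrix.add_mul]
    rw [h1, one_add_sig, conjTranspose_mul]
    simp only [Matrix.mul_smul, Matrix.smul_mul, smul_smul, Matrix.mul_assoc]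
    norm_num
  rw [h]
  exact (hQ.1.add_posSemidef hQ.2).smul (by norm_num)

/-- At `z = i` the adjoint step `I + C j` has rank only `m₁`, but it is injective on nonnegative
subspaces: it equals `C^{1/2} (I + j) C^{1/2} j`, and `D` below satisfies `2 D^* D = Q^* j C j Q +
Q^* j Q > 0`. -/
theorem IsNonnegFrame.step {Q : Matrix (Fin m₁ ⊕ Fin m₂) (Fin m₁) ℂ}
    (hQ : IsNonnegFrame Q) {C : Matrix (Fin m₁ ⊕ Fin m₂) (Fin m₁ ⊕ Fin m₂) ℂ}
    (hC : C.PosDef) (hj : C * sig m₁ m₂ * C = sig m₁ m₂) :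
    IsNonnegFrame ((1 + C * sig m₁ m₂) * Q) := by
  set R := CFC.sqrt C with hRdef
  have hRj : R * sig m₁ m₂ * R = sig m₁ m₂ := sqrt_mul_sig_mul_sqrt hC hj
  have hRR : R * R = C := CFC.sqrt_mul_sqrt_self C hC.posSemidef.nonneg
  have hRH : Rᴴ = R := conjTranspose_sqrt C
  set D := topRow m₁ m₂ * R * sig m₁ m₂ * Q with hD
  have hM : (1 + C * sig m₁ m₂) * Q = (2 : ℂ) • (R * (topRow m₁ m₂)ᴴ * D) := by
    calc _ = R * (1 + sig m₁ m₂) * R * sig m₁ m₂ * Q := by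
          rw [Matrix.mul_add R, Matrix.add_mul _ _ R, hRj, Matrix.mul_one, hRR, Matrix.add_mul C,
            sig_mul_sig, add_comm]
      _ = _ := by
          rw [one_add_sig, hD]
          simp only [Matrix.mul_assoc, Matrix.mul_smul, Matrix.smul_mul]
  have hDH : Dᴴ = Qᴴ * sig m₁ m₂ * R * (topRow m₁ m₂)ᴴ := by
    rw [hD]
    simp only [conjTranspose_mul, conjTranspose_sig, hRH, Matrix.mul_assoc]
  have hjCj : (sig m₁ m₂ * C * sig m₁ m₂).PosDef := by
    have := hC.conjTranspose_mul_mul_same (B := sig m₁ m₂) (mulVec_injective_of_isUnit isUnit_sig)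
    rwa [conjTranspose_sig] at this
  have hDD : IsUnit D := by
    apply isUnit_of_posDef_conjTranspose_mul_self
    have h : Dᴴ * D =
        (2⁻¹ : ℂ) • (Qᴴ * (sig m₁ m₂ * C * sig m₁ m₂) * Q + Qᴴ * sig m₁ m₂ * Q) := by
      have h1 : Qᴴ * (sig m₁ m₂ * C * sig m₁ m₂) * Q + Qᴴ * sig m₁ m₂ * Q =
          Qᴴ * (sig m₁ m₂ * (R * (1 + sig m₁ m₂) * R) * sig m₁ m₂) * Q := by
        rw [Matrix.mul_add R, Matrix.add_mul _ _ R, hRj, Matrix.mul_one, hRR]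
        simp only [Matrix.mul_add, Matrix.add_mul]
        rw [sig_mul_sig, Matrix.one_mul]
      rw [h1, one_add_sig, hDH, hD]
      simp only [Matrix.mul_smul, Matrix.smul_mul, smul_smul, Matrix.mul_assoc]
      norm_num
    rw [h]
    exact ((hjCj.conjTranspose_mul_mul_same (mulVec_injective_of_posDef hQ.1)).add_posSemidef
      hQ.2).smul (by norm_num)
  rw [hM]
  have htC : (topRow m₁ m₂ * C * (topRow m₁ m₂)ᴴ).PosDef := by
    have := hC.conjTranspose_mul_mul_same (B := (topRow m₁ m₂)ᴴ) (mulVec_injective_of_posDef (by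
      rw [conjTranspose_conjTranspose, topRow_mul_conjTranspose]; exact PosDef.one))
    rwa [conjTranspose_conjTranspose] at this
  constructor
  · have h : ((2 : ℂ) • (R * (topRow m₁ m₂)ᴴ * D))ᴴ * ((2 : ℂ) • (R * (topRow m₁ m₂)ᴴ * D)) =
        (4 : ℂ) • (Dᴴ * (topRow m₁ m₂ * C * (topRow m₁ m₂)ᴴ) * D) := by
      rw [← hRR]
      simp only [conjTranspose_smul, conjTranspose_mul, conjTranspose_conjTranspose, hRH,
        Matrix.mul_smul, Matrix.smul_mul, smul_smul, Matrix.mul_assoc]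
      norm_num
    rw [h]
    exact (htC.conjTranspose_mul_mul_same (mulVec_injective_of_isUnit hDD)).smul (by norm_num)
  · have h : ((2 : ℂ) • (R * (topRow m₁ m₂)ᴴ * D))ᴴ * sig m₁ m₂ *
        ((2 : ℂ) • (R * (topRow m₁ m₂)ᴴ * D)) = (4 : ℂ) • (Dᴴ * D) := by
      calc _ = (4 : ℂ) • (Dᴴ * topRow m₁ m₂ * (R * sig m₁ m₂ * R) * (topRow m₁ m₂)ᴴ * D) := by
            simp only [conjTranspose_smul, conjTranspose_mul, conjTranspose_conjTranspose, hRH,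
              Matrix.mul_smul, Matrix.smul_mul, smul_smul, Matrix.mul_assoc]
            norm_num
        _ = _ := by
            rw [hRj, Matrix.mul_assoc (Dᴴ * topRow m₁ m₂), sig_mul_topRow,
              Matrix.mul_assoc Dᴴ, topRow_mul_conjTranspose, Matrix.mul_one]
    rw [h]
    exact (posSemidef_conjTranspose_mul_self D).smul (by norm_num)

end

/-! ### Nilpotent cyclic pairs and block Krylov matrices -/

section Krylov

variable {k d : ℕ}

/-- `X` is strictly block lower triangular with invertible blocks below the diagonal,
and the first block of `B` is invertible. -/
structure IsCyclicPair (X : Matrix (Fin (k + 1) × Fin d) (Fin (k + 1) × Fin d) ℂ)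
    (B : Matrix (Fin (k + 1) × Fin d) (Fin d) ℂ) : Prop where
  lower : ∀ x y, x.1 ≤ y.1 → X x y = 0
  subdiag : ∀ l l' : Fin (k + 1), (l' : ℕ) = l + 1 →
    IsUnit (of fun p q => X (l', p) (l, q) : Matrix (Fin d) (Fin d) ℂ)
  first : IsUnit (of fun p q => B (0, p) q : Matrix (Fin d) (Fin d) ℂ)

variable {X Y : Matrix (Fin (k + 1) × Fin d) (Fin (k + 1) × Fin d) ℂ}
  {B D : Matrix (Fin (k + 1) × Fin d) (Fin d) ℂ}

theorem IsCyclicPair.pow_apply_eq_zero (h : IsCyclicPair X B) (n : ℕ) (x y)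
    (hxy : (x.1 : ℕ) < y.1 + n) : (X ^ n) x y = 0 := by
  induction n generalizing x with
  | zero =>
    rw [pow_zero, one_apply_ne]
    rintro rfl
    omega
  | succ n ih =>
    rw [pow_succ', mul_apply]
    refine Finset.sum_eq_zero fun z _ => ?_
    by_cases hz : x.1 ≤ z.1
    · rw [h.lower _ _ hz, zero_mul]
    · rw [ih z (by rw [not_le, Fin.lt_def] at hz; omega), mul_zero]

theorem IsCyclicPair.pow_eq_zero (h : IsCyclicPair X B) {n : ℕ} (hn : k < n) : X ^ n = 0 := by
  ext x y
  exact h.pow_apply_eq_zero n x y (by omega)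

theorem IsCyclicPair.pow_mul_apply_eq_zero (h : IsCyclicPair X B) (n : ℕ) (x q)
    (hx : (x.1 : ℕ) < n) : (X ^ n * B) x q = 0 := by
  rw [mul_apply]
  refine Finset.sum_eq_zero fun z _ => ?_
  rw [h.pow_apply_eq_zero n x z (by omega), zero_mul]

/-- This block is the product of the first `n` subdiagonal blocks of `X` and the first block of `B`.
-/
theorem IsCyclicPair.isUnit_pow_mul (h : IsCyclicPair X B) (n : Fin (k + 1)) :
    IsUnit (of fun p q => (X ^ (n : ℕ) * B) (n, p) q : Matrix (Fin d) (Fin d) ℂ) := by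
  obtain ⟨n, hn⟩ := n
  induction n with
  | zero => simpa using h.first
  | succ n ih =>
    have ih := ih (by omega)
    convert (h.subdiag ⟨n, by omega⟩ ⟨n + 1, hn⟩ rfl).mul ih using 1
    ext p q
    simp only [of_apply]
    rw [pow_succ', Matrix.mul_assoc, mul_apply, Fintype.sum_prod_type,
      Finset.sum_eq_single (⟨n, by omega⟩ : Fin (k + 1))]
    · rw [mul_apply]; rfl
    · intro l _ hl
      refine Finset.sum_eq_zero fun s _ => ?_
      by_cases hl' : (⟨n + 1, hn⟩ : Fin (k + 1)) ≤ l
      · rw [h.lower _ _ hl', zero_mul]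
      · rw [h.pow_mul_apply_eq_zero n _ _ ?_, mul_zero]
        rw [Fin.le_def] at hl'
        rw [ne_eq, Fin.ext_iff] at hl
        simp only at hl hl' ⊢
        omega
    · simp

/-- The block Krylov matrix `[B, X B, …, X ^ k B]`. -/
def krylov (X : Matrix (Fin (k + 1) × Fin d) (Fin (k + 1) × Fin d) ℂ)
    (B : Matrix (Fin (k + 1) × Fin d) (Fin d) ℂ) :
    Matrix (Fin (k + 1) × Fin d) (Fin (k + 1) × Fin d) ℂ :=
  of fun x y => (X ^ (y.1 : ℕ) * B) x y.2

theorem mul_krylov_apply (M : Matrix (Fin (k + 1) × Fin d) (Fin (k + 1) × Fin d) ℂ) (x y) :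
    (M * krylov X B) x y = (M * (X ^ (y.1 : ℕ) * B)) x y.2 := by
  simp [mul_apply, krylov]

/-- The Krylov matrix is block lower triangular with invertible diagonal blocks; the kernel is
killed by forward substitution. -/
theorem IsCyclicPair.isUnit_krylov (h : IsCyclicPair X B) : IsUnit (krylov X B) := by
  rw [← mulVec_injective_iff_isUnit, ← coe_mulVecLin, ← LinearMap.ker_eq_bot,
    LinearMap.ker_eq_bot']
  intro w hw
  rw [mulVecLin_apply] at hw
  suffices ∀ n : ℕ, ∀ hn : n < k + 1, ∀ q, w (⟨n, hn⟩, q) = 0 by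
    ext ⟨⟨n, hn⟩, q⟩
    exact this n hn q
  intro n
  induction n using Nat.strong_induction_on with
  | _ n ih =>
    intro hn
    have hu := mulVec_injective_of_isUnit (h.isUnit_pow_mul ⟨n, hn⟩)
    have hz : (fun q => w (⟨n, hn⟩, q)) = 0 := by
      apply hu
      rw [mulVec_zero]
      ext p
      have := congrFun hw (⟨n, hn⟩, p)
      rw [mulVec, dotProduct, Fintype.sum_prod_type,
        Finset.sum_eq_single (⟨n, hn⟩ : Fin (k + 1))] at this
      · exact this
      · intro l _ hl
        refine Finset.sum_eq_zero fun s _ => ?_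
        rcases lt_or_gt_of_ne hl with hl | hl
        · rw [ih l hl l.2 s, mul_zero]
        · rw [krylov, of_apply, h.pow_mul_apply_eq_zero _ _ _ hl, zero_mul]
      · simp
    exact fun q => congrFun hz q

theorem IsCyclicPair.mul_right_ext (h : IsCyclicPair X B)
    {M M' : Matrix (Fin (k + 1) × Fin d) (Fin (k + 1) × Fin d) ℂ}
    (hM : ∀ n : ℕ, M * (X ^ n * B) = M' * (X ^ n * B)) : M = M' := by
  have hk : M * krylov X B = M' * krylov X B := by
    ext x y
    rw [mul_krylov_apply, mul_krylov_apply, hM]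
  exact h.isUnit_krylov.mul_right_cancel hk

theorem mul_pow_mul_of_intertwine {E : Matrix (Fin (k + 1) × Fin d) (Fin (k + 1) × Fin d) ℂ}
    (hE : Y * E = E * X) (hB : E * B = D) (n : ℕ) : E * (X ^ n * B) = Y ^ n * D := by
  induction n with
  | zero => simpa using hB
  | succ n ih =>
    rw [pow_succ', Matrix.mul_assoc, ← Matrix.mul_assoc, ← hE, Matrix.mul_assoc, ih, pow_succ',
      Matrix.mul_assoc]

/-- Two cyclic pairs of the same size are similar. -/
theorem IsCyclicPair.exists_intertwine (h : IsCyclicPair X B) (h' : IsCyclicPair Y D) :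
    ∃ E, IsUnit E ∧ Y * E = E * X ∧ E * B = D := by
  have hV : IsUnit (krylov X B) := h.isUnit_krylov
  have hVd := (isUnit_iff_isUnit_det _).1 hV
  have hE : krylov Y D * (krylov X B)⁻¹ * krylov X B = krylov Y D := by
    rw [Matrix.mul_assoc, nonsing_inv_mul _ hVd, Matrix.mul_one]
  -- Powers beyond `k` are not columns of the Krylov matrix; there both sides vanish by nilpotency.
  -- The intertwining relation needs the case `n = k + 1`.
  have hpow : ∀ n : ℕ, krylov Y D * (krylov X B)⁻¹ * (X ^ n * B) = Y ^ n * D := by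
    intro n
    by_cases hn : k < n
    · rw [h.pow_eq_zero hn, h'.pow_eq_zero hn, Matrix.zero_mul, Matrix.zero_mul, Matrix.mul_zero]
    · ext x q
      have := congrFun (congrFun hE x) (⟨n, by omega⟩, q)
      rwa [mul_krylov_apply] at this
  refine ⟨krylov Y D * (krylov X B)⁻¹, ?_, ?_, ?_⟩
  · refine h'.isUnit_krylov.mul ?_
    rw [isUnit_iff_isUnit_det]
    exact isUnit_nonsing_inv_det _ hVd
  · refine h.mul_right_ext fun n => ?_
    rw [Matrix.mul_assoc, hpow, Matrix.mul_assoc _ X, ← Matrix.mul_assoc X, ← pow_succ', hpow,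
      ← Matrix.mul_assoc, ← pow_succ']
  · simpa using hpow 0

theorem IsCyclicPair.pow_mul_eq (h : IsCyclicPair X B) :
    X ^ k * B = (lastRow d k)ᴴ * (of fun p q => (X ^ k * B) (Fin.last k, p) q) := by
  ext ⟨l, p⟩ q
  by_cases hl : l = Fin.last k
  · subst hl
    simp [mul_apply, lastRow, one_apply]
  · rw [h.pow_mul_apply_eq_zero k _ _
      (lt_of_le_of_ne (Nat.lt_succ_iff.1 l.2) fun h' => hl (Fin.ext h'))]
    simp [mul_apply, lastRow, hl]

/-- `E` maps `X^k B` to `Y^k D`, and both columns are supported in the last block, where they are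
invertible. -/
theorem exists_mul_conjTranspose_lastRow (h : IsCyclicPair X B) (h' : IsCyclicPair Y D)
    {E : Matrix (Fin (k + 1) × Fin d) (Fin (k + 1) × Fin d) ℂ}
    (hE : Y * E = E * X) (hB : E * B = D) :
    ∃ e : Matrix (Fin d) (Fin d) ℂ, IsUnit e ∧ E * (lastRow d k)ᴴ = (lastRow d k)ᴴ * e := by
  have hu := h.isUnit_pow_mul (Fin.last k)
  have hu' := h'.isUnit_pow_mul (Fin.last k)
  have hp := mul_pow_mul_of_intertwine hE hB k
  rw [h.pow_mul_eq, h'.pow_mul_eq] at hp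
  simp only [Fin.val_last] at hu hu'
  set g := (of fun p q => (X ^ k * B) (Fin.last k, p) q : Matrix (Fin d) (Fin d) ℂ)
  set g' := (of fun p q => (Y ^ k * D) (Fin.last k, p) q : Matrix (Fin d) (Fin d) ℂ)
  have hgd := (isUnit_iff_isUnit_det _).1 hu
  refine ⟨g' * g⁻¹, hu'.mul ?_, ?_⟩
  · rw [isUnit_iff_isUnit_det]
    exact isUnit_nonsing_inv_det _ hgd
  · rw [← Matrix.mul_assoc, ← hp, Matrix.mul_assoc, Matrix.mul_assoc, mul_nonsing_inv _ hgd,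
      Matrix.mul_one]

end Krylov

/-! ### The similarity of `K_k` and `A_k`, the matrix `S_k`, and recovery of `γ(k)` -/

section

variable {m₁ m₂ : ℕ}

/-- The strictly block lower triangular part of `-i K_k`. -/
noncomputable def strictK (C : ℕ → Matrix (Fin m₁ ⊕ Fin m₂) (Fin m₁ ⊕ Fin m₂) ℂ) (k : ℕ) :
    Matrix (Fin (k + 1) × Fin m₂) (Fin (k + 1) × Fin m₂) ℂ :=
  of fun x y => if y.1 < x.1 then (gam (C x.1) * sig m₁ m₂ * (gam (C y.1))ᴴ) x.2 y.2 else 0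

/-- The strictly block lower triangular part of `i A_k`. -/
noncomputable def strictA (m₂ k : ℕ) : Matrix (Fin (k + 1) × Fin m₂) (Fin (k + 1) × Fin m₂) ℂ :=
  of fun x y => if y.1 < x.1 then (1 : Matrix (Fin m₂) (Fin m₂) ℂ) x.2 y.2 else 0

theorem Amat_eq (m₂ k : ℕ) :
    Amat m₂ k = -(Complex.I • strictA m₂ k) - (Complex.I / 2) • 1 := by
  ext ⟨l, p⟩ ⟨n, q⟩
  simp only [Amat, strictA, of_apply, Matrix.sub_apply, Matrix.neg_apply, Matrix.smul_apply, smul_eq_mul]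
  rcases lt_trichotomy n l with h | h | h
  · simp [h, one_apply, h.ne', apply_ite]
  · subst h; simp [one_apply, apply_ite]
  · simp [h.not_gt, h.ne', h.ne, one_apply]

section

variable {C : ℕ → Matrix (Fin m₁ ⊕ Fin m₂) (Fin m₁ ⊕ Fin m₂) ℂ} {r k : ℕ}

theorem IsPotential.Kmat_eq (hC : IsPotential C r) (hk : k ≤ r) :
    Kmat C k = Complex.I • strictK C k - (Complex.I / 2) • 1 := by
  ext ⟨l, p⟩ ⟨n, q⟩
  simp only [Kmat, strictK, of_apply, Matrix.sub_apply, Matrix.smul_apply, smul_eq_mul]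
  rcases lt_trichotomy n l with h | h | h
  · simp [h, one_apply, h.ne']
  · subst h
    obtain ⟨h1, h2⟩ := hC n (by omega)
    rw [gam_mul_sig_mul_gam h1 h2]
    simp [one_apply]
  · simp [h.not_gt, h.ne', h.ne, one_apply]

theorem isCyclicPair_strictA (m₂ k : ℕ) : IsCyclicPair (strictA m₂ k) (Phi2 m₂ k) where
  lower x y h := by simp [strictA, h.not_gt]
  subdiag l l' h := by
    have hl : l < l' := by rw [Fin.lt_def]; omega
    convert isUnit_one (M := Matrix (Fin m₂) (Fin m₂) ℂ)
    ext p q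
    simp [strictA, hl]
  first := by
    exact isUnit_one (M := Matrix (Fin m₂) (Fin m₂) ℂ)

theorem IsPotential.isCyclicPair (hC : IsPotential C r) (hk : k ≤ r) :
    IsCyclicPair (-strictK C k) (Gam C k).toCols₂ where
  lower x y h := by simp [strictK, h.not_gt]
  subdiag l l' h := by
    have hl : l < l' := by rw [Fin.lt_def]; omega
    obtain ⟨h1, h2⟩ := hC l (by omega)
    obtain ⟨h1', h2'⟩ := hC l' (by omega)
    convert (isUnit_gam_mul_sig_mul_gam h1 h2 h1' h2').neg
    ext p q
    simp [strictK, hl]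
  first := by
    exact isUnit_toCols₂_gam (hC 0 (by omega)).1

/-- The common scalar part `-i/2` cancels, leaving only nilpotent parts. -/
theorem IsPotential.isSimilarity_iff (hC : IsPotential C r) (hk : k ≤ r)
    {E : Matrix (Fin (k + 1) × Fin m₂) (Fin (k + 1) × Fin m₂) ℂ} :
    IsSimilarity C k E ↔
      IsUnit E ∧ -strictK C k * E = E * strictA m₂ k ∧ E * Phi2 m₂ k = (Gam C k).toCols₂ := by
  refine and_congr_right fun hE => ?_
  have hd := (isUnit_iff_isUnit_det _).1 hE
  refine and_congr ?_ ?_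
  · rw [hC.Kmat_eq hk, Amat_eq, Matrix.mul_sub, Matrix.sub_mul, Matrix.mul_smul, Matrix.mul_one,
      Matrix.smul_mul, mul_nonsing_inv _ hd, sub_left_inj, Matrix.mul_neg, Matrix.mul_smul,
      Matrix.neg_mul, Matrix.smul_mul, ← smul_neg,
      smul_right_inj Complex.I_ne_zero]
    constructor
    · intro h
      rw [h, neg_neg, Matrix.mul_assoc, nonsing_inv_mul _ hd, Matrix.mul_one]
    · intro h
      rw [← h, Matrix.mul_assoc, mul_nonsing_inv _ hd, Matrix.mul_one, neg_neg]
  · constructor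
    · intro h
      rw [← h, mul_nonsing_inv_cancel_left _ _ hd]
    · intro h
      rw [← h, nonsing_inv_mul_cancel_left _ _ hd]

theorem IsPotential.existsUnique_isSimilarity (hC : IsPotential C r) (hk : k ≤ r) :
    ∃! E, IsSimilarity C k E := by
  simp only [hC.isSimilarity_iff hk]
  obtain ⟨E, hE⟩ := (isCyclicPair_strictA m₂ k).exists_intertwine (hC.isCyclicPair hk)
  refine ⟨E, hE, fun F hF => (isCyclicPair_strictA m₂ k).mul_right_ext fun n => ?_⟩
  rw [mul_pow_mul_of_intertwine hE.2.1 hE.2.2, mul_pow_mul_of_intertwine hF.2.1 hF.2.2]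

/-- With `N = strictA`, the equation reads `S (1 + N^*) = -N S`. Iterating it `k + 1` times
annihilates the right side, while `1 + N^*` is invertible. -/
theorem mul_eq_mul_conjTranspose_Amat
    {S : Matrix (Fin (k + 1) × Fin m₂) (Fin (k + 1) × Fin m₂) ℂ}
    (h : Amat m₂ k * S = S * (Amat m₂ k)ᴴ) : S = 0 := by
  have hN : strictA m₂ k ^ (k + 1) = 0 := (isCyclicPair_strictA m₂ k).pow_eq_zero (by omega)
  have hS : SemiconjBy S (1 + (strictA m₂ k)ᴴ) (-strictA m₂ k) := by
    have h' := congrArg (fun M => (-Complex.I) • M) h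
    simp only [Amat_eq, conjTranspose_sub, conjTranspose_neg, conjTranspose_smul,
      conjTranspose_one, Matrix.mul_sub, Matrix.sub_mul, Matrix.mul_neg, Matrix.neg_mul,
      Matrix.mul_smul, Matrix.smul_mul, Matrix.mul_one, Matrix.one_mul, smul_sub, smul_neg,
      smul_smul] at h'
    simp only [RCLike.star_def, map_div₀, Complex.conj_I, map_ofNat] at h'
    rw [SemiconjBy, mul_add, mul_one, neg_mul]
    ext x y
    have h'' := congrFun (congrFun h' x) y
    simp only [Matrix.sub_apply, Matrix.neg_apply, Matrix.smul_apply, smul_eq_mul, Matrix.add_apply] at h'' ⊢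
    have hI := Complex.I_mul_I
    linear_combination -h'' +
      ((strictA m₂ k * S) x y + (S * (strictA m₂ k)ᴴ) x y + S x y / 2 + S x y / 2) * hI
  have hp := hS.pow_right (k + 1)
  rw [neg_pow, hN, mul_zero, SemiconjBy, zero_mul] at hp
  have hu : IsUnit (1 + (strictA m₂ k)ᴴ) := by
    refine IsNilpotent.isUnit_one_add ⟨k + 1, ?_⟩
    rw [← conjTranspose_pow, hN, conjTranspose_zero]
  exact (hu.pow (k + 1)).mul_right_cancel (by rw [hp, zero_mul])

theorem SolvesIdentity.unique {a : ℕ → Matrix (Fin m₂) (Fin m₁) ℂ}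
    {S T : Matrix (Fin (k + 1) × Fin m₂) (Fin (k + 1) × Fin m₂) ℂ}
    (hS : SolvesIdentity a k S) (hT : SolvesIdentity a k T) : S = T := by
  rw [← sub_eq_zero]
  apply mul_eq_mul_conjTranspose_Amat
  rw [SolvesIdentity] at hS hT
  rw [Matrix.mul_sub, Matrix.sub_mul]
  have := hS.trans hT.symm
  rw [sub_eq_sub_iff_add_eq_add] at this ⊢
  exact this.trans (add_comm _ _)

theorem Kmat_sub_conjTranspose :
    Kmat C k - (Kmat C k)ᴴ = Complex.I • (Gam C k * sig m₁ m₂ * (Gam C k)ᴴ) := by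
  have hG : ∀ l p n q, (Gam C k * sig m₁ m₂ * (Gam C k)ᴴ) (l, p) (n, q) =
      (gam (C l) * sig m₁ m₂ * (gam (C n))ᴴ) p q := fun _ _ _ _ => rfl
  have hstar : ∀ l n : Fin (k + 1), ∀ p q,
      star ((gam (C n) * sig m₁ m₂ * (gam (C l))ᴴ) q p) =
        (gam (C l) * sig m₁ m₂ * (gam (C n))ᴴ) p q := by
    intro l n p q
    rw [← conjTranspose_apply]
    simp only [conjTranspose_mul, conjTranspose_conjTranspose, conjTranspose_sig,
      Matrix.mul_assoc]
  ext ⟨l, p⟩ ⟨n, q⟩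
  simp only [Matrix.sub_apply, conjTranspose_apply, Matrix.smul_apply, smul_eq_mul, hG, Kmat, of_apply,
    star_mul', hstar]
  rcases lt_trichotomy n l with h | h | h
  · simp [h, h.not_gt, h.ne']
  · subst h
    simp; ring
  · simp [h, h.not_gt, h.ne']

/-- The recovery of `γ(k)^* γ(k)` from a solution `(E, Φ_{k,1})` of the similarity problem. -/
theorem IsSimilarity.recovery (hC : IsPotential C r) (hk : k ≤ r)
    {E : Matrix (Fin (k + 1) × Fin m₂) (Fin (k + 1) × Fin m₂) ℂ} (hE : IsSimilarity C k E)
    {a : ℕ → Matrix (Fin m₂) (Fin m₁) ℂ} (ha : Phi1 a k = E⁻¹ * (Gam C k).toCols₁) :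
    SolvesIdentity a k (E⁻¹ * Eᴴ⁻¹) ∧ (E⁻¹ * Eᴴ⁻¹).PosDef ∧
      IsUnit (lastRow m₂ k * (E⁻¹ * Eᴴ⁻¹)⁻¹ * (lastRow m₂ k)ᴴ) ∧
      (gam (C k))ᴴ * gam (C k) =
        (PiMat a k)ᴴ * (E⁻¹ * Eᴴ⁻¹)⁻¹ * (lastRow m₂ k)ᴴ *
          (lastRow m₂ k * (E⁻¹ * Eᴴ⁻¹)⁻¹ * (lastRow m₂ k)ᴴ)⁻¹ *
          lastRow m₂ k * (E⁻¹ * Eᴴ⁻¹)⁻¹ * PiMat a k := by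
  have hd := (isUnit_iff_isUnit_det _).1 hE.1
  have hdH : IsUnit (Eᴴ).det := by rw [det_conjTranspose]; exact hd.star
  have hPi : E * PiMat a k = Gam C k := by
    rw [PiMat, ha, ← hE.2.2, mul_fromCols, mul_nonsing_inv_cancel_left _ _ hd,
      mul_nonsing_inv_cancel_left _ _ hd, fromCols_toCols]
  have hPi' : PiMat a k = E⁻¹ * Gam C k := by
    rw [← hPi, nonsing_inv_mul_cancel_left _ _ hd]
  have hSinv : (E⁻¹ * Eᴴ⁻¹)⁻¹ = Eᴴ * E := by
    rw [Matrix.mul_inv_rev, nonsing_inv_nonsing_inv _ hd, nonsing_inv_nonsing_inv _ hdH]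
  obtain ⟨-, hE1, hE2⟩ := (hC.isSimilarity_iff hk).1 hE
  obtain ⟨e, he, hEe⟩ := exists_mul_conjTranspose_lastRow (isCyclicPair_strictA m₂ k)
    (hC.isCyclicPair hk) hE1 hE2
  have hed := (isUnit_iff_isUnit_det _).1 he
  have hedH : IsUnit (eᴴ).det := by rw [det_conjTranspose]; exact hed.star
  have hEe' : lastRow m₂ k * Eᴴ = eᴴ * lastRow m₂ k := by
    have := congrArg conjTranspose hEe
    simpa only [conjTranspose_mul, conjTranspose_conjTranspose] using this
  have hPP : lastRow m₂ k * (lastRow m₂ k)ᴴ = 1 := by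
    ext p q
    simp [mul_apply, lastRow, Fintype.sum_prod_type, one_apply, eq_comm]
  have hPG : lastRow m₂ k * Gam C k = gam (C k) := by
    ext p q
    simp [mul_apply, lastRow, Fintype.sum_prod_type, one_apply, Gam]
  -- With `S⁻¹ = E^* E` and `E P^* = P^* e`, the recovery formula becomes `(γ^* e) (e^* e)⁻¹ (e^*
  -- γ)`, in which the unknown `e` cancels.
  have hPSP : lastRow m₂ k * (E⁻¹ * Eᴴ⁻¹)⁻¹ * (lastRow m₂ k)ᴴ = eᴴ * e := by
    rw [hSinv, ← Matrix.mul_assoc, hEe', Matrix.mul_assoc, hEe, Matrix.mul_assoc,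
      ← Matrix.mul_assoc (lastRow m₂ k), hPP, Matrix.one_mul]
  have hR : lastRow m₂ k * (E⁻¹ * Eᴴ⁻¹)⁻¹ * PiMat a k = eᴴ * gam (C k) := by
    rw [hSinv, ← Matrix.mul_assoc, hEe', Matrix.mul_assoc, hPi, Matrix.mul_assoc, hPG]
  have hL : (PiMat a k)ᴴ * (E⁻¹ * Eᴴ⁻¹)⁻¹ * (lastRow m₂ k)ᴴ = (gam (C k))ᴴ * e := by
    have := congrArg conjTranspose hR
    rw [hSinv] at this ⊢
    simpa only [conjTranspose_mul, conjTranspose_conjTranspose, Matrix.mul_assoc] using this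
  refine ⟨?_, ?_, ?_, ?_⟩
  · have hA : Amat m₂ k * E⁻¹ = E⁻¹ * Kmat C k := by
      rw [hE.2.1, Matrix.mul_assoc, nonsing_inv_mul_cancel_left _ _ hd]
    have hA' : Eᴴ⁻¹ * (Amat m₂ k)ᴴ = (Kmat C k)ᴴ * Eᴴ⁻¹ := by
      have := congrArg conjTranspose hA
      simpa only [conjTranspose_mul, conjTranspose_nonsing_inv] using this
    rw [SolvesIdentity, hPi', ← Matrix.mul_assoc, hA, Matrix.mul_assoc E⁻¹ Eᴴ⁻¹, hA',
      conjTranspose_mul, conjTranspose_nonsing_inv]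
    have := congrArg (fun M => E⁻¹ * M * Eᴴ⁻¹) (Kmat_sub_conjTranspose (C := C) (k := k))
    simpa only [Matrix.mul_sub, Matrix.sub_mul, Matrix.mul_smul, Matrix.smul_mul,
      Matrix.mul_assoc] using this
  · rw [← conjTranspose_nonsing_inv]
    apply PosDef.mul_conjTranspose_self
    intro x y hxy
    exact vecMul_injective_of_isUnit
      ((isUnit_iff_isUnit_det _).2 (isUnit_nonsing_inv_det _ hd)) hxy
  · rw [hPSP]
    exact (isUnit_iff_isUnit_det _ |>.2 hedH).mul he
  · rw [Matrix.mul_assoc _ (lastRow m₂ k), Matrix.mul_assoc _ (lastRow m₂ k * _), hPSP, hL, hR,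
      Matrix.mul_inv_rev]
    rw [Matrix.mul_assoc, Matrix.mul_assoc, Matrix.mul_assoc e⁻¹,
      nonsing_inv_mul_cancel_left _ _ hedH, mul_nonsing_inv_cancel_left _ _ hed]

end

end

/-! ### Analyticity of Weyl functions and the recursion in the disk variable -/

section

variable {m₁ m₂ : ℕ}

/-- Entrywise analyticity of a matrix function. -/
def EntriesAnalyticAt {p q : Type*} (F : ℂ → Matrix p q ℂ) (z : ℂ) : Prop :=
  ∀ a b, AnalyticAt ℂ (fun w => F w a b) z

section Analytic

variable {o p q : Type*} {z : ℂ}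

theorem EntriesAnalyticAt.mul [Fintype p] {F : ℂ → Matrix o p ℂ} {G : ℂ → Matrix p q ℂ}
    (hF : EntriesAnalyticAt F z) (hG : EntriesAnalyticAt G z) :
    EntriesAnalyticAt (fun w => F w * G w) z := by
  intro a b
  simp only [mul_apply]
  exact Finset.analyticAt_fun_sum _ fun c _ => (hF a c).fun_mul (hG c b)

theorem entriesAnalyticAt_const (A : Matrix p q ℂ) : EntriesAnalyticAt (fun _ => A) z :=
  fun _ _ => analyticAt_const

theorem EntriesAnalyticAt.neg {F : ℂ → Matrix p q ℂ} (hF : EntriesAnalyticAt F z) :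
    EntriesAnalyticAt (fun w => -F w) z :=
  fun a b => (hF a b).fun_neg

theorem EntriesAnalyticAt.sub {F G : ℂ → Matrix p q ℂ} (hF : EntriesAnalyticAt F z)
    (hG : EntriesAnalyticAt G z) : EntriesAnalyticAt (fun w => F w - G w) z :=
  fun a b => (hF a b).fun_sub (hG a b)

theorem EntriesAnalyticAt.smul {f : ℂ → ℂ} {F : ℂ → Matrix p q ℂ} (hf : AnalyticAt ℂ f z)
    (hF : EntriesAnalyticAt F z) : EntriesAnalyticAt (fun w => f w • F w) z :=
  fun a b => hf.fun_mul (hF a b)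

theorem EntriesAnalyticAt.comp {F : ℂ → Matrix p q ℂ} {f : ℂ → ℂ} {w : ℂ}
    (hF : EntriesAnalyticAt F (f w)) (hf : AnalyticAt ℂ f w) :
    EntriesAnalyticAt (fun x => F (f x)) w :=
  fun a b => (hF a b).fun_comp hf

theorem EntriesAnalyticAt.continuousAt {F : ℂ → Matrix p q ℂ} (hF : EntriesAnalyticAt F z) :
    ContinuousAt F z :=
  continuousAt_pi.2 fun a => continuousAt_pi.2 fun b => (hF a b).continuousAt

theorem EntriesAnalyticAt.det [Fintype p] [DecidableEq p] {F : ℂ → Matrix p p ℂ}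
    (hF : EntriesAnalyticAt F z) : AnalyticAt ℂ (fun w => (F w).det) z := by
  simp only [det_apply']
  exact Finset.analyticAt_fun_sum _ fun σ _ =>
    analyticAt_const.fun_mul (Finset.analyticAt_fun_prod _ fun c _ => hF _ _)

theorem EntriesAnalyticAt.inv [Fintype p] [DecidableEq p] {F : ℂ → Matrix p p ℂ}
    (hF : EntriesAnalyticAt F z) (h : IsUnit (F z)) :
    EntriesAnalyticAt (fun w => (F w)⁻¹) z := by
  intro a b
  simp only [inv_def, Ring.inverse_eq_inv', Matrix.smul_apply, smul_eq_mul, adjugate_apply]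
  refine (hF.det.fun_inv ((isUnit_iff_isUnit_det _).1 h).ne_zero).fun_mul ?_
  refine EntriesAnalyticAt.det fun c d => ?_
  simp only [updateRow_apply]
  split_ifs
  · exact analyticAt_const
  · exact hF _ _

end Analytic

variable {C : ℕ → Matrix (Fin m₁ ⊕ Fin m₂) (Fin m₁ ⊕ Fin m₂) ℂ} {r : ℕ}

theorem IsPotential.conjTranspose_fundSol_succ (hC : IsPotential C r) {k : ℕ} (hk : k ≤ r)
    (z : ℂ) : (fundSol C (star z) (k + 1))ᴴ =
      (fundSol C (star z) k)ᴴ * (1 - (Complex.I * z) • (C k * sig m₁ m₂)) := by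
  rw [fundSol, conjTranspose_mul, conjTranspose_add, conjTranspose_one, conjTranspose_smul,
    conjTranspose_mul, (hC k hk).1.1.eq, conjTranspose_sig, star_mul', star_star]
  simp [sub_eq_add_neg]

theorem IsPotential.isNonnegFrame (hC : IsPotential C r) {Q : Matrix (Fin m₁ ⊕ Fin m₂) (Fin m₁) ℂ}
    (hQ : IsNonnegFrame Q) {n : ℕ} (hn : n ≤ r + 1) :
    IsNonnegFrame ((fundSol C (star Complex.I) n)ᴴ * Q) := by
  induction n generalizing Q with
  | zero => simpa [fundSol] using hQ
  | succ n ih =>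
    rw [hC.conjTranspose_fundSol_succ (by omega), Matrix.mul_assoc, Complex.I_mul_I, neg_smul,
      one_smul, sub_neg_eq_add]
    exact ih (hQ.step (hC n (by omega)).1 (hC n (by omega)).2) (by omega)

/-- The successive images of a matrix function under the factors of `W_n(z̄)^*`. -/
theorem IsPotential.exists_factorization (hC : IsPotential C r) {n : ℕ} (hn : n ≤ r + 1)
    {R : ℂ → Matrix (Fin m₁ ⊕ Fin m₂) (Fin m₁) ℂ} {w : ℂ} (hR : EntriesAnalyticAt R w) :
    ∃ Q : ℕ → ℂ → Matrix (Fin m₁ ⊕ Fin m₂) (Fin m₁) ℂ,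
      Q n = R ∧ (∀ z, Q 0 z = (fundSol C (star z) n)ᴴ * R z) ∧
      (∀ k ≤ n, EntriesAnalyticAt (Q k) w) ∧
      ∀ k < n, ∀ z, Q k z = (1 - (Complex.I * z) • (C k * sig m₁ m₂)) * Q (k + 1) z := by
  induction n generalizing R with
  | zero => exact ⟨fun _ => R, rfl, by simp [fundSol], fun _ _ => hR, by simp⟩
  | succ n ih =>
    have hR' : EntriesAnalyticAt
        (fun z => (1 - (Complex.I * z) • (C n * sig m₁ m₂)) * R z) w :=
      ((entriesAnalyticAt_const 1).sub (EntriesAnalyticAt.smul (by fun_prop)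
        (entriesAnalyticAt_const _))).mul hR
    obtain ⟨Q, hQn, hQ0, hQa, hQs⟩ := ih (by omega) hR'
    refine ⟨fun k => if k ≤ n then Q k else R, by simp, fun z => ?_, fun k hk => ?_,
      fun k hk z => ?_⟩
    · rw [hC.conjTranspose_fundSol_succ (by omega), Matrix.mul_assoc, ← hQ0]
      simp
    · by_cases hkn : k ≤ n
      · simpa [hkn] using hQa k hkn
      · simpa [hkn] using hR
    · rcases Nat.lt_succ_iff_lt_or_eq.1 hk with hk | rfl
      · simpa [hk.le, Nat.succ_le_of_lt hk] using hQs k hk z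
      · simp [hQn]

theorem eventually_nhdsNE_of_codiscreteWithin_upperHalf {p : ℂ → Prop}
    (h : ∀ᶠ z in codiscreteWithin upperHalf, p z) : ∀ᶠ z in 𝓝[≠] Complex.I, p z := by
  have hI : Complex.I ∈ upperHalf := by simp [upperHalf]
  have hU : ∀ᶠ z in 𝓝[≠] Complex.I, z ∈ upperHalf :=
    mem_nhdsWithin_of_mem_nhds
      ((isOpen_lt continuous_const Complex.continuous_im).mem_nhds hI)
  filter_upwards [mem_codiscreteWithin_iff_forall_mem_nhdsNE.1 h _ hI, hU] with z hz hzU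
  exact hz.resolve_right fun hz => hz hzU

/-- The inequality `𝓟^* j 𝓟 ≥ 0` is a closed condition and passes to `i` by continuity; strict
positivity of `𝓟^* 𝓟` would not, and is assumed at `i`. -/
theorem IsParameter.isNonnegFrame {P : ℂ → Matrix (Fin m₁ ⊕ Fin m₂) (Fin m₁) ℂ}
    (hP : IsParameter P) : IsNonnegFrame (P Complex.I) := by
  refine ⟨hP.nonsingular_I, ?_⟩
  have hev : ∀ᶠ z in 𝓝[≠] Complex.I, ((P z)ᴴ * sig m₁ m₂ * P z).PosSemidef :=
    (eventually_nhdsNE_of_codiscreteWithin_upperHalf hP.property_j).mono fun _ h => h.2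
  have hc : ContinuousAt P Complex.I := EntriesAnalyticAt.continuousAt hP.analyticAt_I
  refine PosSemidef.of_dotProduct_mulVec_nonneg ?_ fun x => ?_
  · rw [IsHermitian, conjTranspose_mul, conjTranspose_mul, conjTranspose_conjTranspose,
      conjTranspose_sig, Matrix.mul_assoc]
  · have hc' : ContinuousAt (fun z => star x ⬝ᵥ ((P z)ᴴ * sig m₁ m₂ * P z) *ᵥ x) Complex.I := by
      have hg : Continuous fun A : Matrix (Fin m₁ ⊕ Fin m₂) (Fin m₁) ℂ =>
          star x ⬝ᵥ (Aᴴ * sig m₁ m₂ * A) *ᵥ x := by fun_prop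
      exact hg.continuousAt.comp hc
    refine ge_of_tendsto
      (hc'.tendsto.mono_left (nhdsWithin_le_nhds (s := {Complex.I}ᶜ))) ?_
    filter_upwards [hev] with z hz
    exact hz.dotProduct_mulVec_nonneg x

/-- The half-plane variable `z` as a function of the disk variable `ζ`. -/
noncomputable def cayley (ζ : ℂ) : ℂ := Complex.I * ((1 - ζ) / (1 + ζ))

theorem analyticAt_cayley : AnalyticAt ℂ cayley 0 := by
  unfold cayley
  refine analyticAt_const.fun_mul (AnalyticAt.fun_div ?_ ?_ (by simp)) <;> fun_prop

theorem cayley_zero : cayley 0 = Complex.I := by simp [cayley]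

/-- Put `t = (1 - ζ) / (1 + ζ)`. As `(j C)² = I`, the factors `I + t j C` and `I - t j C` multiply
to the scalar `1 - t² = 4 ζ / (1 + ζ)²`, and `ζ - (1 - ζ) j γ^* γ` is `(1 + ζ) / 2` times the second
one. -/
theorem dirac_step_disk {C : Matrix (Fin m₁ ⊕ Fin m₂) (Fin m₁ ⊕ Fin m₂) ℂ}
    (hC : C.PosDef) (hj : C * sig m₁ m₂ * C = sig m₁ m₂) {ζ : ℂ} (hζ : 1 + ζ ≠ 0)
    (Q : Matrix (Fin m₁ ⊕ Fin m₂) (Fin m₁) ℂ) :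
    ζ • (2 / (1 + ζ)) • (sig m₁ m₂ * Q) =
      ζ • (sig m₁ m₂ * ((1 - (Complex.I * cayley ζ) • (C * sig m₁ m₂)) * Q)) -
      (1 - ζ) • (sig m₁ m₂ * (gam C)ᴴ * gam C *
        (sig m₁ m₂ * ((1 - (Complex.I * cayley ζ) • (C * sig m₁ m₂)) * Q))) := by
  have hG : (gam C)ᴴ * gam C = (2⁻¹ : ℂ) • (C - sig m₁ m₂) := by
    nth_rw 3 [eq_sig_add hC hj]
    rw [add_sub_cancel_left, smul_smul]
    norm_num
  have hz : Complex.I * cayley ζ = -((1 - ζ) / (1 + ζ)) := by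
    rw [cayley, ← mul_assoc, Complex.I_mul_I, neg_one_mul]
  rw [Matrix.mul_assoc (sig m₁ m₂) (gam C)ᴴ, hG, hz]
  have h1 : sig m₁ m₂ * (sig m₁ m₂ * Q) = Q := by
    rw [← Matrix.mul_assoc, sig_mul_sig, Matrix.one_mul]
  have h2 : sig m₁ m₂ * (C * (sig m₁ m₂ * (C * (sig m₁ m₂ * Q)))) = sig m₁ m₂ * Q := by
    rw [← Matrix.mul_assoc C, ← Matrix.mul_assoc (C * _), hj, h1]
  simp only [Matrix.mul_assoc, Matrix.mul_sub, Matrix.sub_mul, Matrix.mul_smul, Matrix.smul_mul,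
    Matrix.one_mul, h2]
  have h3 : sig m₁ m₂ * (sig m₁ m₂ * (C * (sig m₁ m₂ * Q))) = C * (sig m₁ m₂ * Q) := by
    rw [← Matrix.mul_assoc, sig_mul_sig, Matrix.one_mul]
  ext a b
  simp only [h1, h3, Matrix.sub_apply, Matrix.smul_apply, smul_eq_mul]
  field_simp
  ring

/-- Near `ζ = 0`, the Weyl solution `[I; φ]` in the disk variable is divisible by the powers
of `ζ` in the way prescribed by the recursion. -/
theorem IsWeylFunction.exists_jet (hC : IsPotential C r)
    {φ : ℂ → Matrix (Fin m₂) (Fin m₁) ℂ} (hφ : IsWeylFunction C r φ) :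
    EntriesAnalyticAt (onDisk φ) 0 ∧
    ∃ g : ℕ → ℂ → Matrix (Fin m₁ ⊕ Fin m₂) (Fin m₁) ℂ,
      (∀ k ≤ r + 1, EntriesAnalyticAt (g k) 0) ∧
      (∀ᶠ ζ in 𝓝 0, g 0 ζ = fromRows 1 (onDisk φ ζ)) ∧
      ∀ k ≤ r, ∀ᶠ ζ in 𝓝 0, ζ • g (k + 1) ζ =
        ζ • g k ζ - (1 - ζ) • (sig m₁ m₂ * (gam (C k))ᴴ * gam (C k) * g k ζ) := by
  obtain ⟨P, hP, hφP, hφI⟩ := hφ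
  obtain ⟨Q, -, hQ0, hQa, hQs⟩ := hC.exists_factorization le_rfl hP.analyticAt_I
  have hA : EntriesAnalyticAt (fun z => topRow m₁ m₂ * Q 0 z) Complex.I :=
    (entriesAnalyticAt_const _).mul (hQa 0 (by omega))
  have hunit : IsUnit (topRow m₁ m₂ * Q 0 Complex.I) := by
    rw [hQ0]
    exact (hC.isNonnegFrame hP.isNonnegFrame le_rfl).isUnit_topRow_mul
  have hX : EntriesAnalyticAt (fun z => (topRow m₁ m₂ * Q 0 z)⁻¹) Complex.I := hA.inv hunit
  have hev : ∀ᶠ z in 𝓝 Complex.I,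
      φ z = -(botRow m₁ m₂ * Q 0 z) * (topRow m₁ m₂ * Q 0 z)⁻¹ := by
    have h : ∀ᶠ z in 𝓝 Complex.I, φ z = moebius C r z (P z) := by
      rw [← nhdsNE_sup_pure, eventually_sup]
      exact ⟨eventually_nhdsNE_of_codiscreteWithin_upperHalf hφP, by simpa using hφI⟩
    filter_upwards [h] with z hz
    rw [hz, hQ0, moebius, Matrix.mul_assoc (botRow m₁ m₂), Matrix.mul_assoc (topRow m₁ m₂)]
  have htop : ∀ᶠ z in 𝓝 Complex.I, IsUnit (topRow m₁ m₂ * Q 0 z).det := by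
    have := hA.det.continuousAt.eventually_ne ((isUnit_iff_isUnit_det _).1 hunit).ne_zero
    filter_upwards [this] with z hz
    exact hz.isUnit
  have hcay : Tendsto cayley (𝓝 0) (𝓝 Complex.I) := by
    have := analyticAt_cayley.continuousAt.tendsto
    rwa [cayley_zero] at this
  have hcomp : ∀ {p q : Type} {F : ℂ → Matrix p q ℂ}, EntriesAnalyticAt F Complex.I →
      EntriesAnalyticAt (fun ζ => F (cayley ζ)) 0 := fun h =>
    EntriesAnalyticAt.comp (by rwa [cayley_zero]) analyticAt_cayley
  have hne : ∀ᶠ ζ : ℂ in 𝓝 0, 1 + ζ ≠ 0 := by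
    have : ContinuousAt (fun ζ : ℂ => 1 + ζ) 0 := by fun_prop
    exact this.eventually_ne (by simp)
  have h2 : AnalyticAt ℂ (fun ζ : ℂ => 2 / (1 + ζ)) 0 :=
    analyticAt_const.fun_div (by fun_prop) (by simp)
  -- Each step contributes the scalar `2 / (1 + ζ)` of `dirac_step_disk`. The common right factor
  -- normalizes the upper block of `g 0` to `I`, and `j` corrects the sign of `φ`.
  refine ⟨?_, fun k ζ => (2 / (1 + ζ)) ^ k •
    (sig m₁ m₂ * (Q k (cayley ζ) * (topRow m₁ m₂ * Q 0 (cayley ζ))⁻¹)), ?_, ?_, ?_⟩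
  · have h : EntriesAnalyticAt φ Complex.I := by
      intro a b
      have h := ((((entriesAnalyticAt_const (botRow m₁ m₂)).mul (hQa 0 (by omega))).neg.mul hX) a b)
      refine h.congr ?_
      filter_upwards [hev] with z hz
      rw [hz]
    exact hcomp h
  · intro k hk
    exact EntriesAnalyticAt.smul (h2.fun_pow k)
      ((entriesAnalyticAt_const _).mul ((hcomp (hQa k hk)).mul (hcomp hX)))
  · filter_upwards [hcay.eventually hev, hcay.eventually htop] with ζ hζ ht
    set B := Q 0 (cayley ζ) * (topRow m₁ m₂ * Q 0 (cayley ζ))⁻¹ with hB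
    have ht' : topRow m₁ m₂ * B = 1 := by
      rw [hB, ← Matrix.mul_assoc, mul_nonsing_inv _ ht]
    have hb' : botRow m₁ m₂ * B = -onDisk φ ζ := by
      rw [hB, ← Matrix.mul_assoc]
      change _ = -φ (cayley ζ)
      rw [hζ, Matrix.neg_mul, neg_neg]
    have hB' : B = fromRows 1 (-onDisk φ ζ) := by
      rw [← ht', ← hb', ← fromRows_mul, topRow, botRow]
      conv_lhs => rw [← Matrix.one_mul B]
      congr 1
      ext (i | i) (l | l) <;> simp [one_apply]
    rw [pow_zero, one_smul, hB', sig, fromBlocks_mul_fromRows]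
    simp
  · intro k hk
    filter_upwards [hne] with ζ hζ
    have h := dirac_step_disk (hC k hk).1 (hC k hk).2 hζ
      (Q (k + 1) (cayley ζ) * (topRow m₁ m₂ * Q 0 (cayley ζ))⁻¹)
    rw [← Matrix.mul_assoc (1 - _), ← hQs k (by omega)] at h
    ext a b
    have hab := congrFun (congrFun h a) b
    simp only [Matrix.mul_smul, Matrix.sub_apply, Matrix.smul_apply, smul_eq_mul] at hab ⊢
    linear_combination (2 / (1 + ζ)) ^ k * hab

end

/-! ### Comparison of coefficients -/

theorem isBigO_pow_pow {n k : ℕ} (h : n ≤ k) :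
    (fun z : ℂ => z ^ k) =O[𝓝[≠] 0] fun z => z ^ n := by
  refine Asymptotics.IsBigO.of_bound 1 ?_
  have : ∀ᶠ z : ℂ in 𝓝[≠] 0, z ∈ Metric.ball (0 : ℂ) 1 :=
    mem_nhdsWithin_of_mem_nhds (Metric.ball_mem_nhds (0 : ℂ) one_pos)
  filter_upwards [this] with z hz
  rw [mem_ball_zero_iff] at hz
  rw [one_mul, norm_pow, norm_pow]
  exact pow_le_pow_of_le_one (norm_nonneg _) hz.le h

theorem coeff_eq_zero_of_isBigO (p : Polynomial ℂ) {n : ℕ}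
    (h : (fun z => p.eval z) =O[𝓝[≠] 0] fun z : ℂ => z ^ n) : ∀ i < n, p.coeff i = 0 := by
  induction n with
  | zero => simp
  | succ n ih =>
    have ih := ih (h.trans (isBigO_pow_pow n.le_succ))
    obtain ⟨q, rfl⟩ := Polynomial.X_pow_dvd_iff.2 ih
    intro i hi
    rcases Nat.lt_succ_iff_lt_or_eq.1 hi with hi | rfl
    · exact ih i hi
    have hq : (fun z => q.eval z) =O[𝓝[≠] 0] fun z : ℂ => z := by
      have hinv := (Asymptotics.isBigO_refl (fun z : ℂ => (z ^ i)⁻¹) (𝓝[≠] 0)).mul h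
      refine (hinv.congr' ?_ ?_)
      · filter_upwards [self_mem_nhdsWithin] with z hz
        have hz : z ≠ 0 := hz
        simp [hz]
      · filter_upwards [self_mem_nhdsWithin] with z hz
        have hz : z ≠ 0 := hz
        field_simp
        ring
    have h0 : Tendsto (fun z => q.eval z) (𝓝[≠] 0) (𝓝 0) :=
      hq.trans_tendsto (tendsto_id.mono_left nhdsWithin_le_nhds)
    have h1 : Tendsto (fun z => q.eval z) (𝓝[≠] 0) (𝓝 (q.eval 0)) :=
      q.continuous.continuousAt.tendsto.mono_left nhdsWithin_le_nhds
    have := tendsto_nhds_unique h0 h1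
    rw [Polynomial.coeff_X_pow_mul', if_pos le_rfl, Nat.sub_self,
      Polynomial.coeff_zero_eq_eval_zero, ← this]

theorem one_sub_mul_sum_pow {n k : ℕ} (h : n ≤ k) (z : ℂ) :
    (1 - z) * ∑ l ∈ Finset.range (k + 1), (if n < l then z ^ l else 0) =
      z ^ (n + 1) - z ^ (k + 1) := by
  induction k, h using Nat.le_induction with
  | base =>
    rw [Finset.sum_eq_zero, mul_zero, sub_self]
    intro l hl
    rw [if_neg (by rw [Finset.mem_range] at hl; omega)]
  | succ k h ih =>
    rw [Finset.sum_range_succ, mul_add, ih, if_pos (by omega)]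
    ring

section

variable {m d k : ℕ}

/-- The block row `[I, ζ I, …, ζ ^ k I]`. -/
noncomputable def powRow (d k : ℕ) (ζ : ℂ) : Matrix (Fin d) (Fin (k + 1) × Fin d) ℂ :=
  of fun p x => ζ ^ (x.1 : ℕ) * (1 : Matrix (Fin d) (Fin d) ℂ) p x.2

theorem powRow_mul_apply (ζ : ℂ) (M : Matrix (Fin (k + 1) × Fin d) (Fin m) ℂ) (p q) :
    (powRow d k ζ * M) p q = ∑ l : Fin (k + 1), ζ ^ (l : ℕ) * M (l, p) q := by
  simp [mul_apply, powRow, Fintype.sum_prod_type, one_apply]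

/-- In every block column the geometric sum telescopes: `ζ^{n+1} - (ζ^{n+1} - ζ^{k+1})`. -/
theorem powRow_mul_resolvent (ζ : ℂ) :
    powRow d k ζ * (ζ • 1 - (1 - ζ) • strictA d k) = ζ ^ (k + 1) • powRow d k 1 := by
  ext p ⟨n, q⟩
  have h1 : (powRow d k ζ * strictA d k) p (n, q) =
      (∑ l ∈ Finset.range (k + 1), if (n : ℕ) < l then ζ ^ l else 0) *
        (1 : Matrix (Fin d) (Fin d) ℂ) p q := by
    rw [← Fin.sum_univ_eq_sum_range (fun l => if (n : ℕ) < l then ζ ^ l else 0)]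
    simp only [mul_apply, powRow, strictA, of_apply, Fintype.sum_prod_type, Finset.sum_mul]
    refine Finset.sum_congr rfl fun l _ => ?_
    by_cases h : n < l
    · simp [h, one_apply, Fin.lt_def.1 h]
    · simp [h, mt Fin.lt_def.2 h]
  simp only [Matrix.mul_sub, Matrix.mul_smul, Matrix.mul_one, Matrix.sub_apply,
    Matrix.smul_apply, smul_eq_mul, h1]
  rw [← mul_assoc, one_sub_mul_sum_pow (Nat.lt_succ_iff.1 n.2)]
  simp only [powRow, of_apply]
  ring

/-- Multiplying a power series by `1 + z + … + z^k` turns its coefficients up to order `k` into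
partial sums. -/
theorem sum_block_eq {F : Fin (k + 1) → Matrix (Fin d) (Fin m) ℂ}
    {f : ℂ → Matrix (Fin d) (Fin m) ℂ} {a : ℕ → Matrix (Fin d) (Fin m) ℂ} {r : ℕ} (hk : k ≤ r)
    {p : Fin d} {q : Fin m}
    (hf : (fun z : ℂ => f z p q - ∑ j ∈ Finset.range (r + 1), z ^ j * a j p q)
      =O[𝓝[≠] 0] fun z : ℂ => z ^ (k + 1))
    (hF : (fun z : ℂ => ∑ l : Fin (k + 1), z ^ (l : ℕ) * (F l p q + f z p q))
      =O[𝓝[≠] 0] fun z : ℂ => z ^ (k + 1)) (l : Fin (k + 1)) :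
    F l p q = -∑ j ∈ Finset.range ((l : ℕ) + 1), a j p q := by
  set P : Polynomial ℂ := ∑ l : Fin (k + 1), Polynomial.X ^ (l : ℕ) * Polynomial.C (F l p q) +
    (∑ l ∈ Finset.range (k + 1), Polynomial.X ^ l) *
      ∑ j ∈ Finset.range (r + 1), Polynomial.X ^ j * Polynomial.C (a j p q) with hP
  have hbound : (fun z : ℂ => ∑ l ∈ Finset.range (k + 1), z ^ l) =O[𝓝[≠] 0]
      fun _ => (1 : ℂ) := by
    have : ContinuousAt (fun z : ℂ => ∑ l ∈ Finset.range (k + 1), z ^ l) 0 := by fun_prop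
    exact (this.tendsto.isBigO_one ℂ).mono nhdsWithin_le_nhds
  have hO : (fun z => P.eval z) =O[𝓝[≠] 0] fun z : ℂ => z ^ (k + 1) := by
    have h := hF.sub ((hbound.mul hf).congr_right fun z => one_mul _)
    refine h.congr_left fun z => ?_
    rw [hP]
    simp only [Polynomial.eval_add, Polynomial.eval_mul, Polynomial.eval_finsetSum,
      Polynomial.eval_pow, Polynomial.eval_X, Polynomial.eval_C, mul_add, Finset.sum_add_distrib]
    rw [← Finset.sum_mul, Fin.sum_univ_eq_sum_range (fun l => z ^ l)]
    ring
  have hc := coeff_eq_zero_of_isBigO P hO l l.2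
  have h1 : (∑ n : Fin (k + 1), Polynomial.X ^ (n : ℕ) * Polynomial.C (F n p q)).coeff l =
      F l p q := by
    simp only [Polynomial.finsetSum_coeff, Polynomial.coeff_X_pow_mul', Polynomial.coeff_C]
    rw [Finset.sum_eq_single l]
    · simp
    · intro n _ hn
      have : (n : ℕ) ≠ l := fun h => hn (Fin.ext h)
      split_ifs <;> first | rfl | omega
    · simp
  have h2 : ((∑ n ∈ Finset.range (k + 1), Polynomial.X ^ n) *
      ∑ j ∈ Finset.range (r + 1), Polynomial.X ^ j * Polynomial.C (a j p q)).coeff l =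
      ∑ j ∈ Finset.range ((l : ℕ) + 1), a j p q := by
    rw [Polynomial.coeff_mul, Finset.Nat.sum_antidiagonal_eq_sum_range_succ_mk,
      ← Finset.sum_range_reflect]
    refine Finset.sum_congr rfl fun j hj => ?_
    rw [Finset.mem_range] at hj
    have hl := l.2
    have e1 : (∑ n ∈ Finset.range (k + 1), (Polynomial.X : Polynomial ℂ) ^ n).coeff
        ((l : ℕ) + 1 - 1 - j) = 1 := by
      simp only [Polynomial.finsetSum_coeff, Polynomial.coeff_X_pow]
      rw [Finset.sum_ite_eq, if_pos (by rw [Finset.mem_range]; omega)]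
    have e2 : (∑ n ∈ Finset.range (r + 1),
        (Polynomial.X : Polynomial ℂ) ^ n * Polynomial.C (a n p q)).coeff j = a j p q := by
      simp only [Polynomial.finsetSum_coeff, Polynomial.coeff_X_pow_mul', Polynomial.coeff_C]
      rw [Finset.sum_eq_single j]
      · simp
      · intro n _ hn
        split_ifs <;> first | rfl | omega
      · intro h
        exact absurd (Finset.mem_range.2 (by omega)) h
    simp only [e1, one_mul]
    rw [show (l : ℕ) - ((l : ℕ) + 1 - 1 - j) = j by omega, e2]
  rw [hP, Polynomial.coeff_add, h1, h2] at hc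
  exact eq_neg_of_add_eq_zero_left hc

end

/-! ### Taylor coefficients of the Weyl function and `E_k⁻¹ Γ_{k,1}` -/

variable {m₁ m₂ : ℕ} {C : ℕ → Matrix (Fin m₁ ⊕ Fin m₂) (Fin m₁ ⊕ Fin m₂) ℂ} {r k : ℕ}

/-- The block column with the blocks `γ(l) u_{l+1}`, `0 ≤ l ≤ k`. -/
noncomputable def gamCol (C : ℕ → Matrix (Fin m₁ ⊕ Fin m₂) (Fin m₁ ⊕ Fin m₂) ℂ) (k : ℕ)
    (u : ℕ → Matrix (Fin m₁ ⊕ Fin m₂) (Fin m₁) ℂ) :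
    Matrix (Fin (k + 1) × Fin m₂) (Fin m₁) ℂ :=
  of fun x q => (gam (C x.1) * u (x.1 + 1)) x.2 q

theorem IsPotential.gamCol_identity (hC : IsPotential C r) (hk : k ≤ r) {ζ : ℂ} (hζ : ζ ≠ 0)
    {u : ℕ → Matrix (Fin m₁ ⊕ Fin m₂) (Fin m₁) ℂ}
    (hu : ∀ l ≤ r, ζ • u (l + 1) =
      ζ • u l - (1 - ζ) • (sig m₁ m₂ * (gam (C l))ᴴ * gam (C l) * u l)) :
    (ζ • 1 + (1 - ζ) • strictK C k) * gamCol C k u = Gam C k * u 0 := by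
  -- Here `γ j γ^* = -I` merges the two terms. The resulting factor `ζ` can be cancelled from the
  -- recursion, which then telescopes in `hsum`.
  have hgam : ∀ l ≤ r, gam (C l) * u l = ζ • (gam (C l) * u (l + 1)) := by
    intro l hl
    have h := congrArg (fun M => gam (C l) * M) (hu l hl)
    simp only [Matrix.mul_sub, Matrix.mul_smul, ← Matrix.mul_assoc] at h
    rw [gam_mul_sig_mul_gam (hC l hl).1 (hC l hl).2, Matrix.neg_mul, Matrix.neg_mul,
      Matrix.one_mul] at h
    rw [h]
    module
  have hsum : ∀ l ≤ r + 1, u l = u 0 - (1 - ζ) •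
      ∑ n ∈ Finset.range l, sig m₁ m₂ * (gam (C n))ᴴ * (gam (C n) * u (n + 1)) := by
    intro l hl
    induction l with
    | zero => simp
    | succ l ih =>
      have h := hu l (by omega)
      rw [Matrix.mul_assoc _ (gam (C l)), hgam l (by omega), Matrix.mul_smul, smul_comm _ ζ,
        ← smul_sub] at h
      rw [smul_right_injective _ hζ h, Finset.sum_range_succ, smul_add, ← sub_sub,
        ← ih (by omega)]
  ext ⟨l, p⟩ q
  have hl := l.2
  have hL : (strictK C k * gamCol C k u) (l, p) q = (gam (C l) *
      ∑ n ∈ Finset.range l, sig m₁ m₂ * (gam (C n))ᴴ * (gam (C n) * u (n + 1))) p q := by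
    have h1 : ∀ n : Fin (k + 1), ∑ s, strictK C k (l, p) (n, s) * gamCol C k u (n, s) q =
        if (n : ℕ) < l then (gam (C l) *
          (sig m₁ m₂ * (gam (C n))ᴴ * (gam (C n) * u (n + 1)))) p q else 0 := by
      intro n
      by_cases h : n < l
      · rw [if_pos (Fin.lt_def.1 h), ← Matrix.mul_assoc (gam (C l)), ← Matrix.mul_assoc (gam (C l)),
          mul_apply]
        simp [strictK, gamCol, h]
      · rw [if_neg (mt Fin.lt_def.2 h)]
        simp [strictK, h]
    rw [mul_apply, Fintype.sum_prod_type]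
    simp only [h1]
    rw [Fin.sum_univ_eq_sum_range (fun n => if n < (l : ℕ) then (gam (C l) *
          (sig m₁ m₂ * (gam (C n))ᴴ * (gam (C n) * u (n + 1)))) p q else 0),
      ← Finset.sum_filter, Matrix.mul_sum, Matrix.sum_apply]
    refine Finset.sum_congr ?_ fun _ _ => rfl
    ext n
    simp only [Finset.mem_filter, Finset.mem_range]
    omega
  have h0 : (Gam C k * u 0) (l, p) q = (gam (C l) * u 0) p q := rfl
  have hy : ζ * gamCol C k u (l, p) q = (gam (C l) * u l) p q := by
    rw [hgam l (by omega)]; rfl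
  rw [Matrix.add_mul, Matrix.add_apply, Matrix.smul_mul, Matrix.smul_mul, Matrix.smul_apply,
    Matrix.smul_apply, Matrix.one_mul, hL, h0, smul_eq_mul, smul_eq_mul, hy,
    hsum l (by omega)]
  simp only [Matrix.mul_sub, Matrix.mul_smul, Matrix.sub_apply, Matrix.smul_apply, smul_eq_mul]
  ring

/-- The Taylor coefficients of the Weyl function are read off from `E_k⁻¹ Γ_{k,1}`. -/
theorem IsWeylFunction.phi1_eq (hC : IsPotential C r) {φ : ℂ → Matrix (Fin m₂) (Fin m₁) ℂ}
    (hφ : IsWeylFunction C r φ) {a : ℕ → Matrix (Fin m₂) (Fin m₁) ℂ} (ha : HasTaylor φ r a)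
    (hk : k ≤ r) {E : Matrix (Fin (k + 1) × Fin m₂) (Fin (k + 1) × Fin m₂) ℂ}
    (hE : IsSimilarity C k E) : Phi1 a k = E⁻¹ * (Gam C k).toCols₁ := by
  obtain ⟨-, g, hga, hg0, hg⟩ := hφ.exists_jet hC
  have hd := (isUnit_iff_isUnit_det _).1 hE.1
  obtain ⟨-, hE1, hE2⟩ := (hC.isSimilarity_iff hk).1 hE
  have hE1' : E⁻¹ * strictK C k = -(strictA m₂ k * E⁻¹) := by
    have h := congrArg (fun M => E⁻¹ * M * E⁻¹) hE1
    simp only [Matrix.mul_assoc, mul_nonsing_inv _ hd, Matrix.mul_one] at h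
    rw [nonsing_inv_mul_cancel_left _ _ hd, Matrix.mul_neg] at h
    rw [← h, neg_neg]
  set η : ℂ → Matrix (Fin (k + 1) × Fin m₂) (Fin m₁) ℂ :=
    fun ζ => E⁻¹ * gamCol C k (fun l => g l ζ) with hη
  -- The right side is `O(ζ^{k+1})`, since `η` is analytic at `0`. The identity is obtained off `ζ =
  -- 0`, where division by `ζ` is allowed.
  have key : ∀ᶠ ζ in 𝓝[≠] (0 : ℂ),
      powRow m₂ k ζ * (E⁻¹ * (Gam C k).toCols₁ + Phi2 m₂ k * onDisk φ ζ) =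
        ζ ^ (k + 1) • (powRow m₂ k 1 * η ζ) := by
    have hg' : ∀ᶠ ζ in 𝓝 0, ∀ l ∈ Set.Iic r, ζ • g (l + 1) ζ = ζ • g l ζ -
        (1 - ζ) • (sig m₁ m₂ * (gam (C l))ᴴ * gam (C l) * g l ζ) :=
      (Set.finite_Iic r).eventually_all.2 fun l hl => hg l hl
    filter_upwards [self_mem_nhdsWithin, mem_nhdsWithin_of_mem_nhds hg0,
      mem_nhdsWithin_of_mem_nhds hg'] with ζ hζ h0 hs
    have hid := hC.gamCol_identity hk hζ (u := fun l => g l ζ) hs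
    have h0 : g 0 ζ = fromRows 1 (onDisk φ ζ) := h0
    simp only [h0] at hid
    have hlin : (ζ • 1 - (1 - ζ) • strictA m₂ k) * η ζ =
        E⁻¹ * ((ζ • 1 + (1 - ζ) • strictK C k) * gamCol C k (fun l => g l ζ)) := by
      rw [hη, ← Matrix.mul_assoc, ← Matrix.mul_assoc]
      congr 1
      rw [Matrix.mul_add, Matrix.sub_mul, Matrix.mul_smul, Matrix.mul_smul, hE1']
      simp [sub_eq_add_neg]
    have hcols : Gam C k * (fromRows 1 (onDisk φ ζ) : Matrix (Fin m₁ ⊕ Fin m₂) (Fin m₁) ℂ) =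
        (Gam C k).toCols₁ + (Gam C k).toCols₂ * onDisk φ ζ := by
      conv_lhs => rw [← fromCols_toCols (Gam C k), fromCols_mul_fromRows, Matrix.mul_one]
    rw [hid, hcols, Matrix.mul_add, ← Matrix.mul_assoc E⁻¹ (Gam C k).toCols₂, hE.2.2] at hlin
    rw [← hlin, ← Matrix.mul_assoc, powRow_mul_resolvent, Matrix.smul_mul]
  have hηa : EntriesAnalyticAt (fun ζ => powRow m₂ k 1 * η ζ) 0 := by
    refine (entriesAnalyticAt_const _).mul ((entriesAnalyticAt_const _).mul fun x q => ?_)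
    exact ((entriesAnalyticAt_const (gam (C x.1))).mul (hga (x.1 + 1) (by omega))) x.2 q
  ext ⟨l, p⟩ q
  simp only [Phi1, of_apply]
  symm
  refine sum_block_eq (F := fun l => of fun p q => (E⁻¹ * (Gam C k).toCols₁) (l, p) q)
    (f := onDisk φ) hk ?_ ?_ l
  · refine ((ha p q).mono nhdsWithin_le_nhds).trans ?_
    exact isBigO_pow_pow (by omega)
  · have hO : (fun ζ : ℂ => ζ ^ (k + 1) * (powRow m₂ k 1 * η ζ) p q) =O[𝓝[≠] 0]
        fun ζ : ℂ => ζ ^ (k + 1) := by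
      have h1 := ((hηa p q).continuousAt.tendsto.isBigO_one ℂ).mono
        (nhdsWithin_le_nhds (s := {(0 : ℂ)}ᶜ))
      exact ((Asymptotics.isBigO_refl (fun ζ : ℂ => ζ ^ (k + 1)) _).mul h1).congr_right
        fun z => mul_one _
    refine hO.congr' ?_ EventuallyEq.rfl
    filter_upwards [key] with ζ hζ
    have h := congrFun (congrFun hζ p) q
    rw [powRow_mul_apply] at h
    refine h.symm.trans (Finset.sum_congr rfl fun n _ => ?_)
    congr 1
    rw [Matrix.add_apply]
    congr 1
    simp [mul_apply, Phi2, one_apply]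

theorem exists_hasTaylor {φ : ℂ → Matrix (Fin m₂) (Fin m₁) ℂ}
    (h : EntriesAnalyticAt (onDisk φ) 0) (r : ℕ) : ∃ a, HasTaylor φ r a := by
  choose s hs using h
  refine ⟨fun k => of fun p q => (s p q).coeff k, fun p q => ?_⟩
  have h := (hs p q).isBigO_sub_partialSum_pow (r + 1)
  refine Asymptotics.IsBigO.of_norm_right ?_
  simp only [zero_add, ← norm_pow] at h
  simpa [FormalMultilinearSeries.partialSum] using h

end DiscreteDirac

theorem theorem4p4 (m₁ m₂ r : ℕ) (hm₁ : m₁ ≠ 0) (hm₂ : m₂ ≠ 0)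
    (C : ℕ → Matrix (Fin m₁ ⊕ Fin m₂) (Fin m₁ ⊕ Fin m₂) ℂ)
    (hC : DiscreteDirac.IsPotential C r)
    (φ : ℂ → Matrix (Fin m₂) (Fin m₁) ℂ)
    (hφ : DiscreteDirac.IsWeylFunction C r φ) :
    -- the Taylor coefficients at `z = 0` exist
    (∀ p q, AnalyticAt ℂ (fun z => DiscreteDirac.onDisk φ z p q) 0) ∧
    (∃ a, DiscreteDirac.HasTaylor φ r a) ∧
    ∀ a : ℕ → Matrix (Fin m₂) (Fin m₁) ℂ, DiscreteDirac.HasTaylor φ r a →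
      -- uniqueness of the potential with the given first `r + 1` Taylor coefficients
      (∀ (C' : ℕ → Matrix (Fin m₁ ⊕ Fin m₂) (Fin m₁ ⊕ Fin m₂) ℂ)
        (φ' : ℂ → Matrix (Fin m₂) (Fin m₁) ℂ),
        DiscreteDirac.IsPotential C' r → DiscreteDirac.IsWeylFunction C' r φ' →
        DiscreteDirac.HasTaylor φ' r a → ∀ k ≤ r, C' k = C k) ∧
      -- recovery procedure
      ∀ k ≤ r,
        (∃! E, DiscreteDirac.IsSimilarity C k E) ∧
        (∃! S, DiscreteDirac.SolvesIdentity a k S) ∧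
        (∀ E, DiscreteDirac.IsSimilarity C k E →
          DiscreteDirac.Phi1 a k = E⁻¹ * (DiscreteDirac.Gam C k).toCols₁ ∧
          DiscreteDirac.SolvesIdentity a k (E⁻¹ * Eᴴ⁻¹)) ∧
        (∀ S, DiscreteDirac.SolvesIdentity a k S →
          S.PosDef ∧
          IsUnit (DiscreteDirac.lastRow m₂ k * S⁻¹ * (DiscreteDirac.lastRow m₂ k)ᴴ) ∧
          (DiscreteDirac.gam (C k))ᴴ * DiscreteDirac.gam (C k) =
            (DiscreteDirac.PiMat a k)ᴴ * S⁻¹ * (DiscreteDirac.lastRow m₂ k)ᴴ *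
              (DiscreteDirac.lastRow m₂ k * S⁻¹ * (DiscreteDirac.lastRow m₂ k)ᴴ)⁻¹ *
              DiscreteDirac.lastRow m₂ k * S⁻¹ * DiscreteDirac.PiMat a k) ∧
        C k = DiscreteDirac.sig m₁ m₂ +
          (2 : ℂ) • ((DiscreteDirac.gam (C k))ᴴ * DiscreteDirac.gam (C k)) := by
  have han := (hφ.exists_jet hC).1
  refine ⟨han, DiscreteDirac.exists_hasTaylor han r, fun a ha => ⟨?_, fun k hk => ?_⟩⟩
  · intro C' φ' hC' hφ' ha' k hk
    obtain ⟨E, hE, -⟩ := hC.existsUnique_isSimilarity hk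
    obtain ⟨E', hE', -⟩ := hC'.existsUnique_isSimilarity hk
    obtain ⟨h1, -, -, h2⟩ := hE.recovery hC hk (hφ.phi1_eq hC ha hk hE)
    obtain ⟨h1', -, -, h2'⟩ := hE'.recovery hC' hk (hφ'.phi1_eq hC' ha' hk hE')
    -- Both potentials lead to the same `Π_k`, hence to the same `S_k`.
    rw [DiscreteDirac.eq_sig_add (hC' k hk).1 (hC' k hk).2,
      DiscreteDirac.eq_sig_add (hC k hk).1 (hC k hk).2, h2, h2', h1'.unique h1]
  · obtain ⟨E, hE, hEu⟩ := hC.existsUnique_isSimilarity hk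
    have hrec := hE.recovery hC hk (hφ.phi1_eq hC ha hk hE)
    refine ⟨⟨E, hE, hEu⟩, ⟨_, hrec.1, fun S hS => hS.unique hrec.1⟩, fun F hF => ?_,
      fun S hS => ?_, DiscreteDirac.eq_sig_add (hC k hk).1 (hC k hk).2⟩
    · have hF1 := hφ.phi1_eq hC ha hk hF
      exact ⟨hF1, (hF.recovery hC hk hF1).1⟩
    · rw [hS.unique hrec.1]
      exact hrec.2
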